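/- **Strong consistency of SPS for ARX systems.** Let $n_a,n_b\ge 0$, $d=n_a+n_b$, and let $\theta=[a_1,\dots,a_{n_a},b_1,\dots,b_{n_b}]^{\mathrm T}\in\mathbb R^d$ denote a generic parameter, with polynomials $A(z^{-1};\theta)=1+\sum_{k=1}^{n_a}a_kz^{-k}$ and $B(z^{-1};\theta)=\sum_{k=1}^{n_b}b_kz^{-k}$. Let $\Theta_c\subset\mathbb R^d$ be compact and let $\theta^*=[a_1^*,\dots,b_{n_b}^*]^{\mathrm T}\in\Theta_c$ be a deterministic true parameter. The data are generated by $$Y_t=\varphi_t^{\mathrm T}\theta^*+N_t,\qquad \varphi_t=[-Y_{t-1},\dots,-Y_{t-n_a},U_{t-1},\dots,U_{t-n_b}]^{\mathrm T},\qquad t\ge 1,$$ with $Y_t=U_t=N_t=0$ for $t\le 0$ and a deterministic input $(U_t)_{t\ge1}$. Assume: 1. (orders) the coefficient of $z^{-n_a}$ in $A(z^{-1};\theta^*)$ and the coefficient of $z^{-n_b}$ in $B(z^{-1};\theta^*)$ are not both zero; 2. (coprimeness) $A(z^{-1};\theta^*)$ and $B(z^{-1};\theta^*)$ are coprime polynomials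 in $z^{-1}$; 3. (uniform stability) with $\sum_{t\ge0}h_t(\theta)z^{-t}=1/A(z^{-1};\theta)$ and $\sum_{t\ge1}g_t(\theta)z^{-t}=B(z^{-1};\theta)/A(z^{-1};\theta)$ there are summable sequences $\bar h_t,\bar g_t$ with $|h_t(\theta)|\le\bar h_t$ and $|g_t(\theta)|\le\bar g_t$ for all $t$ and all $\theta\in\Theta_c$; 4. (persistent excitation) the limits $\mu_U=\lim_n\frac1n\sum_{t=1}^nU_t$ and $c_{U,k}=\lim_n\frac1n\sum_{t=1}^n(U_t-\mu_U)(U_{t-k}-\mu_U)$, $k\ge 0$, exist and are finite, the Toeplitz matrix $(c_{U,|i-j|})_{i,j=1}^{d}$ is positive definite, and $\limsup_n\frac1n\sum_{t=1}^nU_t^4<\infty$; 5. (noise) $(N_t)_{t\ge1}$ are independent random variables; for every $n$ and all signs $s_1,\dots,s_n\in\{1,-1\}$ the vectors $(s_1N_1,\dots,s_nN_n)$ and $(N_1,\dots,N_n)$ have the same distribution; $\lim_n\frac1n\sum_{t=1}^n\mathbb E[N_t^2]$ exists and is finite, and $\limsup_n\frac1n\sum_{t=1}^n\mathbb E[N_t^8]<\infty$.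 Let $m>q>0$ be integers, let $\alpha_{i,t}$ ($1\le i\le m-1$, $t\ge1$) be i.i.d. random signs ($\pm1$ with probability $\frac12$ each), independent of the noise, and for each sample size $n$ let $\pi_n$ be a uniformly distributed random permutation of $\{0,\dots,m-1\}$, independent of the noise and the signs (for example the same permutation for all $n$). Put $\hat N_t(\theta)=Y_t-\varphi_t^{\mathrm T}\theta$. For $1\le i\le m-1$ let $\bar Y_{i,t}(\theta)$ be given by $$\bar Y_{i,t}(\theta)=\bar\varphi_{i,t}(\theta)^{\mathrm T}\theta+\alpha_{i,t}\hat N_t(\theta),\qquad \bar\varphi_{i,t}(\theta)=[-\bar Y_{i,t-1}(\theta),\dots,-\bar Y_{i,t-n_a}(\theta),U_{t-1},\dots,U_{t-n_b}]^{\mathrm T},\qquad t\ge1,$$ with $\bar Y_{i,t}(\theta)=0$ for $t\le0$. Let $$S_0(\theta)=\Big(\tfrac1n\sum_{t=1}^n\varphi_t\varphi_t^{\mathrm T}\Big)^{-1/2}\tfrac1n\sum_{t=1}^n\varphi_t\hat N_t(\theta),\qquad S_i(\theta)=\Big(\tfrac1n\sum_{t=1}^n\bar\varphi_{i,t}(\theta)\bar\varphi_{i,t}(\theta)^{\mathrm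 T}\Big)^{-1/2}\tfrac1n\sum_{t=1}^n\alpha_{i,t}\bar\varphi_{i,t}(\theta)\hat N_t(\theta),$$ where $^{-1/2}$ is the (pseudo)inverse of the principal square root. Let $\mathcal R(\theta)$ be the rank of $\|S_0(\theta)\|^2$ in the ascending order of $\|S_0(\theta)\|^2,\dots,\|S_{m-1}(\theta)\|^2$, where ties are broken by $\pi_n$ (of two equal values, the one whose index has the larger image under $\pi_n$ counts as the larger), and let $$\widehat\Theta_n=\{\theta\in\Theta_c:\mathcal R(\theta)\le m-q\}.$$ Then for every $\varepsilon>0$, with probability one there is an $\bar n$ such that $\widehat\Theta_n\subseteq\{\theta\in\mathbb R^d:\|\theta-\theta^*\|\le\varepsilon\}$ for all $n\ge\bar n$. -/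

import Mathlib

open MeasureTheory ProbabilityTheory Filter Topology
open scoped Matrix Polynomial ENNReal

noncomputable section

namespace SPS

/-- Parameter vectors `θ = [a_1, …, a_{n_a}, b_1, …, b_{n_b}]` with the Euclidean norm; `a_{k+1}` is
the coordinate `Sum.inl k` and `b_{k+1}` is the coordinate `Sum.inr k`. -/
abbrev Param (na nb : ℕ) : Type := EuclideanSpace ℝ (Fin na ⊕ Fin nb)

/-! ### Signals and ARX systems

A signal is a function `x : ℕ → ℝ`, of which only the samples `x 1, x 2, …` are used; all signals
are zero at the times `t ≤ 0`. -/

/-- The sample `x_{t-k}` of a signal that is zero at all times `≤ 0`. -/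
def delayed (x : ℕ → ℝ) (t k : ℕ) : ℝ := if k < t then x (t - k) else 0

/-- The regressor `φ_t = [-y_{t-1}, …, -y_{t-n_a}, u_{t-1}, …, u_{t-n_b}]`. -/
def regressor (na nb : ℕ) (y u : ℕ → ℝ) (t : ℕ) : Fin na ⊕ Fin nb → ℝ :=
  Sum.elim (fun k => -delayed y t (k + 1)) (fun k => delayed u t (k + 1))

variable {na nb : ℕ}

/-- The output `y` of the ARX system with parameter `θ`, input `u` and noise `e`, started from
zero initial conditions, that is
`y_t + a_1 y_{t-1} + ⋯ + a_{n_a} y_{t-n_a} = b_1 u_{t-1} + ⋯ + b_{n_b} u_{t-n_b} + e_t`, `t ≥ 1`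
(see `arxOutput_eq`). -/
def arxOutput (θ : Param na nb) (u e : ℕ → ℝ) : ℕ → ℝ
  | 0 => 0
  | t + 1 =>
      (∑ k : Fin na, (if (k : ℕ) < t then -arxOutput θ u e (t - k) else 0) * θ (Sum.inl k))
        + (∑ k : Fin nb, delayed u (t + 1) (k + 1) * θ (Sum.inr k)) + e (t + 1)
termination_by t => t
decreasing_by omega

/-- The prediction errors `N̂_t(θ) = y_t - φ_tᵀ θ`. -/
def predError (y u : ℕ → ℝ) (θ : Param na nb) (t : ℕ) : ℝ :=
  y t - ∑ j, regressor na nb y u t j * θ j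

/-- `arxOutput` satisfies the ARX equation in linear regression form `y_t = φ_tᵀ θ + e_t`. -/
theorem arxOutput_eq (θ : Param na nb) (u e : ℕ → ℝ) {t : ℕ} (ht : 1 ≤ t) :
    arxOutput θ u e t
      = ∑ j, regressor na nb (arxOutput θ u e) u t j * θ j + e t := by
  obtain ⟨s, rfl⟩ : ∃ s, t = s + 1 := ⟨t - 1, by omega⟩
  rw [arxOutput, Fintype.sum_sum_type]
  congr 2
  refine Finset.sum_congr rfl fun k _ => ?_
  by_cases hk : (k : ℕ) < s <;> simp [regressor, delayed, hk]

/-! ### The SPS confidence region -/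

/-- The sample covariance matrix `(1/n) ∑_{t=1}^n φ_t φ_tᵀ`. -/
def sampleCov (φ : ℕ → Fin na ⊕ Fin nb → ℝ) (n : ℕ) :
    Matrix (Fin na ⊕ Fin nb) (Fin na ⊕ Fin nb) ℝ :=
  (n : ℝ)⁻¹ • ∑ t ∈ Finset.Icc 1 n, Matrix.vecMulVec (φ t) (φ t)

/-- For a symmetric positive semidefinite matrix `R`, the pseudoinverse of its principal square
root: in an orthonormal eigenbasis, an eigenvalue `x > 0` becomes `1 / √x`, and `0` stays `0`.
If `R` is positive definite, this is the inverse of the principal square root. -/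
def invSqrt (R : Matrix (Fin na ⊕ Fin nb) (Fin na ⊕ Fin nb) ℝ) :
    Matrix (Fin na ⊕ Fin nb) (Fin na ⊕ Fin nb) ℝ :=
  cfc (fun x : ℝ => (√x)⁻¹) R

/-- The vector `((1/n) ∑ φ_t φ_tᵀ)^{-1/2} (1/n) ∑ ε_t φ_t` (sums over `t = 1, …, n`). -/
def shapedSum (φ : ℕ → Fin na ⊕ Fin nb → ℝ) (ε : ℕ → ℝ) (n : ℕ) : Param na nb :=
  WithLp.toLp 2 (invSqrt (sampleCov φ n) *ᵥ ((n : ℝ)⁻¹ • ∑ t ∈ Finset.Icc 1 n, ε t • φ t))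

/-- The perturbed outputs `Ȳ_t(θ)`: the output of the system with parameter `θ` fed with the input
`u` and the sign-perturbed prediction errors `s_t N̂_t(θ)`. -/
def perturbedOutput (y u s : ℕ → ℝ) (θ : Param na nb) : ℕ → ℝ :=
  arxOutput θ u (fun t => s t * predError y u θ t)

variable {m : ℕ} [NeZero m]

/-- The reference sum `S_0(θ)` and the sign-perturbed sums `S_i(θ)`, `i = 1, …, m - 1`, for the
outputs `y`, the inputs `u` and the signs `s i t` (where `s 0` is not used). -/
def signPerturbedSum (y u : ℕ → ℝ) (s : Fin m → ℕ → ℝ) (n : ℕ) (θ : Param na nb) (i : Fin m) :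
    Param na nb :=
  if i = 0 then shapedSum (regressor na nb y u) (predError y u θ) n
  else shapedSum (regressor na nb (perturbedOutput y u (s i) θ) u)
    (fun t => s i t * predError y u θ t) n

/-- The strict total order `Z_k ≻_π Z_j`, in which ties are broken by the permutation `π`. -/
def Exceeds (π : Equiv.Perm (Fin m)) (Z : Fin m → ℝ) (k j : Fin m) : Prop :=
  Z j < Z k ∨ (Z k = Z j ∧ π j < π k)

open Classical in
/-- The rank of `Z_0` among `Z_0, …, Z_{m-1}` in the ascending order w.r.t. `≻_π`; it is `1` if
`Z_0` is the smallest. -/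
def rankZero (π : Equiv.Perm (Fin m)) (Z : Fin m → ℝ) : ℕ :=
  1 + (Finset.univ.filter fun j : Fin m => Exceeds π Z 0 j).card

/-- The SPS confidence region with level `1 - q/m` from a sample of size `n`, among the parameters
in the set `Θc` of allowed values. -/
def region (Θc : Set (Param na nb)) (q : ℕ) (y u : ℕ → ℝ) (s : Fin m → ℕ → ℝ)
    (π : Equiv.Perm (Fin m)) (n : ℕ) : Set (Param na nb) :=
  {θ | θ ∈ Θc ∧ rankZero π (fun i => ‖signPerturbedSum y u s n θ i‖ ^ 2) ≤ m - q}

/-! ### Assumptions on the system and on the input -/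

/-- `A(z⁻¹; θ) = 1 + a_1 z⁻¹ + ⋯ + a_{n_a} z^{-n_a}` as a polynomial in the indeterminate `z⁻¹`. -/
def polyA (θ : Param na nb) : ℝ[X] :=
  1 + ∑ k : Fin na, Polynomial.C (θ (Sum.inl k)) * Polynomial.X ^ ((k : ℕ) + 1)

/-- `B(z⁻¹; θ) = b_1 z⁻¹ + ⋯ + b_{n_b} z^{-n_b}` as a polynomial in the indeterminate `z⁻¹`. -/
def polyB (θ : Param na nb) : ℝ[X] :=
  ∑ k : Fin nb, Polynomial.C (θ (Sum.inr k)) * Polynomial.X ^ ((k : ℕ) + 1)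

/-- The coefficient `h_t(θ)` of `z^{-t}` in the expansion of `1 / A(z⁻¹; θ)` in powers of `z⁻¹`. -/
def coeffH (θ : Param na nb) (t : ℕ) : ℝ :=
  PowerSeries.coeff t ((polyA θ : PowerSeries ℝ)⁻¹)

/-- The coefficient `g_t(θ)` of `z^{-t}` in the expansion of `B(z⁻¹; θ) / A(z⁻¹; θ)` in powers of
`z⁻¹`. -/
def coeffG (θ : Param na nb) (t : ℕ) : ℝ :=
  PowerSeries.coeff t ((polyB θ : PowerSeries ℝ) * (polyA θ : PowerSeries ℝ)⁻¹)

/-- Uniform stability of the filters `1/A(z⁻¹; θ)` and `B(z⁻¹; θ)/A(z⁻¹; θ)`, `θ ∈ Θc`: their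
impulse responses are dominated, uniformly in `θ`, by summable sequences. -/
def UniformlyStable (Θc : Set (Param na nb)) : Prop :=
  (∃ hbar : ℕ → ℝ, Summable hbar ∧ ∀ θ ∈ Θc, ∀ t, |coeffH θ t| ≤ hbar t) ∧
  (∃ gbar : ℕ → ℝ, Summable gbar ∧ ∀ θ ∈ Θc, ∀ t, |coeffG θ t| ≤ gbar t)

/-- The input `u` is persistently exciting of order `r`: the mean and all the sample
autocovariances converge, and the Toeplitz matrix of the first `r` limits is positive definite. -/
def PersistentlyExciting (u : ℕ → ℝ) (r : ℕ) : Prop :=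
  ∃ (mean : ℝ) (c : ℕ → ℝ),
    Tendsto (fun n : ℕ => (∑ t ∈ Finset.Icc 1 n, u t) / n) atTop (𝓝 mean) ∧
    (∀ k, Tendsto (fun n : ℕ =>
      (∑ t ∈ Finset.Icc 1 n, (u t - mean) * (delayed u t k - mean)) / n) atTop (𝓝 (c k))) ∧
    (Matrix.of fun i j : Fin r => c ((i : ℤ) - (j : ℤ)).natAbs).PosDef

/-! ### Assumptions on the noise and on the randomisation -/

variable {Ω : Type*} [MeasurableSpace Ω]

/-- For every `n`, the noise vector `(N_1, …, N_n)` is symmetrically distributed about zero: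
changing the signs of any of its entries does not change its joint distribution. -/
def SymmetricNoise (N : ℕ → Ω → ℝ) (μ : Measure Ω) : Prop :=
  ∀ (n : ℕ) (s : Fin n → ℝ), (∀ t, s t = 1 ∨ s t = -1) →
    IdentDistrib (fun ω (t : Fin n) => s t * N (t + 1) ω) (fun ω (t : Fin n) => N (t + 1) ω) μ μ

/-- Moment conditions: `(1/n) ∑_{t=1}^n E[N_t²]` converges to a finite limit, and
`limsup (1/n) ∑_{t=1}^n E[N_t⁸] < ∞`, where the eighth moments are taken in `[0, ∞]`. -/
def NoiseMoments (N : ℕ → Ω → ℝ) (μ : Measure Ω) : Prop :=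
  (∃ c : ℝ, Tendsto (fun n : ℕ => (∑ t ∈ Finset.Icc 1 n, ∫ ω, N t ω ^ 2 ∂μ) / n) atTop (𝓝 c)) ∧
  limsup (fun n : ℕ => (∑ t ∈ Finset.Icc 1 n, ∫⁻ ω, ‖N t ω‖ₑ ^ 8 ∂μ) / (n : ℝ≥0∞)) atTop < ∞

/-- `α_{i,t}`, `i = 1, …, m - 1`, `t = 1, 2, …`, are i.i.d. random signs. -/
structure RandomSigns (α : Fin m → ℕ → Ω → ℝ) (μ : Measure Ω) : Prop where
  measurable : ∀ i, i ≠ 0 → ∀ t, 1 ≤ t → Measurable (α i t)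
  prob_one : ∀ i, i ≠ 0 → ∀ t, 1 ≤ t → μ {ω | α i t ω = 1} = 1 / 2
  prob_neg_one : ∀ i, i ≠ 0 → ∀ t, 1 ≤ t → μ {ω | α i t ω = -1} = 1 / 2
  indep : iIndepFun (fun p : {i : Fin m // i ≠ 0} × ℕ => α p.1 (p.2 + 1)) μ

/-- `π` is a uniformly distributed random permutation of `{0, …, m - 1}`. -/
structure UniformPermutation (π : Ω → Equiv.Perm (Fin m)) (μ : Measure Ω) : Prop where
  measurable : Measurable fun ω => (⇑(π ω) : Fin m → Fin m)
  uniform : ∀ σ : Equiv.Perm (Fin m), μ {ω | π ω = σ} = 1 / (m.factorial : ℝ≥0∞)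

/-- The noise sequence `(N_t)_{t ≥ 1}` as one random element. -/
def noisePath (N : ℕ → Ω → ℝ) (ω : Ω) : ℕ → ℝ := fun t => N (t + 1) ω

/-- The array of signs `(α_{i,t})`, `1 ≤ i ≤ m - 1`, `t ≥ 1`, as one random element. -/
def signPath (α : Fin m → ℕ → Ω → ℝ) (ω : Ω) : {i : Fin m // i ≠ 0} × ℕ → ℝ :=
  fun p => α p.1 (p.2 + 1) ω

end SPS

end

/-! Signals are read as power series in `X`, standing for `z⁻¹`: a delay is multiplication by `X`,
an ARX system is the identity `A y = B u + e`, and all estimates concern sample correlations `corr`.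
Uniformity in the parameter is carried by `Dom` (filters with a common summable majorant), `BddPow`
(signals of bounded power) and `Uncorr` (correlations vanishing uniformly). The workhorse is
`Uncorr.mul_right`: signals uncorrelated at every relevant lag stay so after dominated filtering.

Fix a sample path on which the laws of large numbers in `NoiseRegular` and `SignsRegular` hold. The
remaining argument is deterministic and uniform over `θ ∈ Θc` at distance at least `ε` from `θ*`:
eventually `‖S_0‖² ≥ c`, while `‖S_i‖² < c` for every `i ≠ 0`. Such a `θ` has rank `m > m - q` and
is excluded.

Reference sum. The prediction error is `N + φᵀ(θ* - θ)`, and `N` is asymptotically uncorrelated with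
the strictly causal `φ`. Writing `R` for the sample covariance, `x = θ* - θ` and `v` for the
unnormalised sum, the bound `‖R^{-1/2} v‖² ≥ 2 v·x - x·Rx` leaves about `x·Rx`. To see that `R` is
uniformly positive, filter `φᵀl` with `A(θ*)`: this gives `(B(l) A(θ*) - (A(l) - 1) B(θ*)) u - (A(l)
- 1) e`. The polynomial before `u` (`crossPoly`) has no constant term and degree at most `na + nb`,
and for `l ≠ 0` it is nonzero by coprimeness and the order condition, so persistent excitation gives
it power.

Perturbed sums. The sequence `α_t N̂_t(θ)` behaves like white noise uncorrelated with the input, so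
the unnormalised sums tend to zero. Normalising them needs excitation at every `θ`, where
coprimeness may fail. If `crossPoly` vanishes for some `l ≠ 0`, then `l` has a nonzero
autoregressive part, and `(A(l) - 1)` applied to the perturbed noise has power: away from `θ*` the
prediction errors, hence the perturbed noise, have power bounded below.

Laws of large numbers. Each required average has terms that are an innovation (a noise sample, a
centred squared noise sample, or a sign) times a predictable factor. For the signs, the whole noise
path is put into the initial `σ`-algebra. Fourth moments give square integrability; martingale
convergence and Kronecker's lemma conclude. -/

noncomputable section

namespace SPS

open scoped PowerSeries
open PowerSeries (coeff)

/-! ### Sample correlations of signals, written as power series -/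

/-- The power series of a signal, with the sample at time `0` replaced by `0`. -/
def sig (x : ℕ → ℝ) : ℝ⟦X⟧ := PowerSeries.mk fun t => if t = 0 then 0 else x t

/-- The pointwise product of two signals. -/
def had (f g : ℝ⟦X⟧) : ℝ⟦X⟧ := PowerSeries.mk fun t => coeff t f * coeff t g

/-- The sample correlation `(1/n) ∑_{t ≤ n} f_t g_t`. -/
def corr (n : ℕ) (f g : ℝ⟦X⟧) : ℝ := (∑ t ∈ Finset.range (n + 1), coeff t f * coeff t g) / n

theorem coeff_had (f g : ℝ⟦X⟧) (t : ℕ) : coeff t (had f g) = coeff t f * coeff t g := by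
  simp [had]

theorem coeff_sig_zero (x : ℕ → ℝ) : coeff 0 (sig x) = 0 := by simp [sig]

theorem coeff_sig (x : ℕ → ℝ) {t : ℕ} (ht : t ≠ 0) : coeff t (sig x) = x t := by simp [sig, ht]

/-- At `t = k` both sides vanish because `sig` suppresses the sample at time `0`; zero initial
conditions are thereby built into multiplication by `X`. -/
theorem coeff_X_pow_mul_sig (x : ℕ → ℝ) (k t : ℕ) :
    coeff t (PowerSeries.X ^ k * sig x) = delayed x t k := by
  rw [PowerSeries.coeff_X_pow_mul', delayed]
  rcases lt_trichotomy k t with h | h | h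
  · rw [if_pos h.le, if_pos h, coeff_sig _ (by omega)]
  · subst h; simp [coeff_sig_zero]
  · rw [if_neg (by omega), if_neg (by omega)]

theorem had_comm (f g : ℝ⟦X⟧) : had f g = had g f := by
  ext t; simp only [coeff_had]; ring

theorem had_assoc (f g h : ℝ⟦X⟧) : had (had f g) h = had f (had g h) := by
  ext t; simp only [coeff_had]; ring

theorem X_pow_mul_had (k : ℕ) (f g : ℝ⟦X⟧) :
    PowerSeries.X ^ k * had f g = had (PowerSeries.X ^ k * f) (PowerSeries.X ^ k * g) := by
  ext t
  simp only [coeff_had, PowerSeries.coeff_X_pow_mul']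
  split_ifs <;> simp

theorem corr_comm (n : ℕ) (f g : ℝ⟦X⟧) : corr n f g = corr n g f := by
  simp only [corr, mul_comm]

theorem corr_add_right (n : ℕ) (f g h : ℝ⟦X⟧) : corr n f (g + h) = corr n f g + corr n f h := by
  simp only [corr, map_add, mul_add, Finset.sum_add_distrib, add_div]

theorem corr_sub_right (n : ℕ) (f g h : ℝ⟦X⟧) : corr n f (g - h) = corr n f g - corr n f h := by
  simp only [corr, map_sub, mul_sub, Finset.sum_sub_distrib, sub_div]

theorem corr_add_left (n : ℕ) (f g h : ℝ⟦X⟧) : corr n (g + h) f = corr n g f + corr n h f := by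
  simp only [corr_comm n _ f, corr_add_right]

theorem corr_sub_left (n : ℕ) (f g h : ℝ⟦X⟧) : corr n (g - h) f = corr n g f - corr n h f := by
  simp only [corr_comm n _ f, corr_sub_right]

theorem corr_had (n : ℕ) (a f g : ℝ⟦X⟧) : corr n (had a f) g = corr n f (had a g) := by
  simp only [corr, coeff_had]
  congr 1
  exact Finset.sum_congr rfl fun t _ => by ring

theorem corr_self_nonneg (n : ℕ) (f : ℝ⟦X⟧) : 0 ≤ corr n f f :=
  div_nonneg (Finset.sum_nonneg fun _ _ => mul_self_nonneg _) n.cast_nonneg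

theorem abs_corr_le (n : ℕ) (f g : ℝ⟦X⟧) : |corr n f g| ≤ (corr n f f + corr n g g) / 2 := by
  have h1 := corr_self_nonneg n (f + g)
  have h2 := corr_self_nonneg n (f - g)
  simp only [corr_add_left, corr_add_right, corr_sub_left, corr_sub_right, corr_comm n g f]
    at h1 h2
  rw [abs_le]; constructor <;> linarith

theorem corr_add_self_le (n : ℕ) (f g : ℝ⟦X⟧) :
    corr n (f + g) (f + g) ≤ 2 * corr n f f + 2 * corr n g g := by
  have h2 := corr_self_nonneg n (f - g)
  simp only [corr_add_left, corr_add_right, corr_sub_left, corr_sub_right, corr_comm n g f]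
    at h2 ⊢
  linarith

theorem sum_X_pow_mul (n k : ℕ) (f g : ℝ⟦X⟧) :
    ∑ t ∈ Finset.range (n + k + 1), coeff t (PowerSeries.X ^ k * f) *
      coeff t (PowerSeries.X ^ k * g) = ∑ t ∈ Finset.range (n + 1), coeff t f * coeff t g := by
  rw [show n + k + 1 = k + (n + 1) by ring, Finset.sum_range_add, Finset.sum_eq_zero, zero_add]
  · refine Finset.sum_congr rfl fun t _ => ?_
    rw [add_comm k t, PowerSeries.coeff_X_pow_mul, PowerSeries.coeff_X_pow_mul]
  · intro t ht
    rw [PowerSeries.coeff_X_pow_mul', if_neg (by simpa using ht), zero_mul]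

theorem corr_X_pow_mul {n : ℕ} (hn : n ≠ 0) (k : ℕ) (f g : ℝ⟦X⟧) :
    corr (n + k) (PowerSeries.X ^ k * f) (PowerSeries.X ^ k * g)
      = (n : ℝ) / (n + k : ℕ) * corr n f g := by
  rw [corr, corr, sum_X_pow_mul]; field_simp

theorem corr_X_pow_mul_of_lt {n k : ℕ} (h : n < k) (f g : ℝ⟦X⟧) :
    corr n f (PowerSeries.X ^ k * g) = 0 := by
  rw [corr, Finset.sum_eq_zero, zero_div]
  intro t ht
  rw [PowerSeries.coeff_X_pow_mul', if_neg (by have := Finset.mem_range.1 ht; omega), mul_zero]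

theorem corr_X_pow_mul_self_le (n k : ℕ) (f : ℝ⟦X⟧) :
    corr n (PowerSeries.X ^ k * f) (PowerSeries.X ^ k * f) ≤ corr n f f := by
  rcases lt_or_ge n k with h | h
  · rw [corr_X_pow_mul_of_lt h]; exact corr_self_nonneg n f
  · obtain ⟨m, rfl⟩ := Nat.exists_eq_add_of_le' h
    rw [corr, corr, sum_X_pow_mul]
    exact div_le_div_of_nonneg_right (Finset.sum_le_sum_of_subset_of_nonneg
      (Finset.range_mono (by omega)) fun t _ _ => mul_self_nonneg (coeff t f)) (Nat.cast_nonneg _)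

theorem coeff_mul_eq_sum (h f : ℝ⟦X⟧) {t n : ℕ} (ht : t ≤ n) :
    coeff t (h * f) = ∑ k ∈ Finset.range (n + 1), coeff k h * coeff t (PowerSeries.X ^ k * f) := by
  rw [PowerSeries.coeff_mul, Finset.Nat.sum_antidiagonal_eq_sum_range_succ_mk]
  have hs : Finset.range t.succ ⊆ Finset.range (n + 1) := Finset.range_mono (by omega)
  rw [← Finset.sum_subset hs]
  · refine Finset.sum_congr rfl fun k hk => ?_
    rw [PowerSeries.coeff_X_pow_mul', if_pos (by have := Finset.mem_range.1 hk; omega)]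
  · intro k _ hk
    rw [PowerSeries.coeff_X_pow_mul', if_neg (by simpa using hk), mul_zero]

theorem corr_mul_eq_sum (n : ℕ) (a h f : ℝ⟦X⟧) :
    corr n a (h * f)
      = ∑ k ∈ Finset.range (n + 1), coeff k h * corr n a (PowerSeries.X ^ k * f) := by
  simp only [corr, ← mul_div_assoc, ← Finset.sum_div, Finset.mul_sum]
  rw [Finset.sum_comm]
  congr 1
  refine Finset.sum_congr rfl fun t ht => ?_
  rw [coeff_mul_eq_sum h f (by simpa [Nat.lt_succ_iff] using ht : t ≤ n), Finset.mul_sum]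
  exact Finset.sum_congr rfl fun k _ => by ring

/-- Young's inequality for convolutions: Cauchy–Schwarz with weights `|h_k|` at each time, after
which every delayed copy of `f` has at most the power of `f`, since a delay only drops the last
samples. -/
theorem corr_mul_self_le (n : ℕ) (h f : ℝ⟦X⟧) :
    corr n (h * f) (h * f) ≤ (∑ k ∈ Finset.range (n + 1), |coeff k h|) ^ 2 * corr n f f := by
  set s := Finset.range (n + 1)
  set H := ∑ k ∈ s, |coeff k h|
  have hH : 0 ≤ H := Finset.sum_nonneg fun _ _ => abs_nonneg _
  have key : ∀ t ∈ s, coeff t (h * f) * coeff t (h * f) ≤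
      H * ∑ k ∈ s, |coeff k h| * (coeff t (PowerSeries.X ^ k * f)) ^ 2 := by
    intro t ht
    rw [coeff_mul_eq_sum h f (by simpa [s, Nat.lt_succ_iff] using ht : t ≤ n), ← pow_two]
    refine Finset.sum_sq_le_sum_mul_sum_of_sq_le_mul s (fun _ _ => abs_nonneg _)
      (fun _ _ => by positivity) fun k _ => ?_
    rw [← mul_assoc, ← pow_two, sq_abs, mul_pow]
  have h2 : ∑ t ∈ s, H * ∑ k ∈ s, |coeff k h| * (coeff t (PowerSeries.X ^ k * f)) ^ 2
      = H * ∑ k ∈ s, |coeff k h| *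
        ∑ t ∈ s, coeff t (PowerSeries.X ^ k * f) * coeff t (PowerSeries.X ^ k * f) := by
    rw [← Finset.mul_sum, Finset.sum_comm]
    simp only [Finset.mul_sum, pow_two]
  calc corr n (h * f) (h * f)
      ≤ (H * ∑ k ∈ s, |coeff k h| *
        ∑ t ∈ s, coeff t (PowerSeries.X ^ k * f) * coeff t (PowerSeries.X ^ k * f)) / n := by
        rw [corr, ← h2]; exact div_le_div_of_nonneg_right (Finset.sum_le_sum key) n.cast_nonneg
    _ = H * ∑ k ∈ s, |coeff k h| *
        corr n (PowerSeries.X ^ k * f) (PowerSeries.X ^ k * f) := by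
        simp only [corr, ← mul_div_assoc, ← Finset.sum_div]; rfl
    _ ≤ H * ∑ k ∈ s, |coeff k h| * corr n f f := by
        gcongr with k _; exact corr_X_pow_mul_self_le n k f
    _ = H ^ 2 * corr n f f := by rw [← Finset.sum_mul]; ring

/-! ### Families of filters and signals -/

variable {ι : Type*}

/-- The coefficients of all power series of the family are dominated by one summable sequence. -/
def Dom (h : ι → ℝ⟦X⟧) : Prop := ∃ b : ℕ → ℝ, Summable b ∧ ∀ i k, |coeff k (h i)| ≤ b k

/-- The sample powers of all signals of the family are bounded by one constant. -/
def BddPow (f : ι → ℝ⟦X⟧) : Prop := ∃ C : ℝ, ∀ n i, corr n (f i) (f i) ≤ C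

/-- The sample correlations of two families of signals tend to `0`, uniformly in the index. -/
def Uncorr (f g : ι → ℝ⟦X⟧) : Prop :=
  Tendsto (fun p : ℕ × ι => corr p.1 (f p.2) (g p.2)) (atTop ×ˢ ⊤) (𝓝 0)

theorem Dom.add {g h : ι → ℝ⟦X⟧} (hg : Dom g) (hh : Dom h) : Dom fun i => g i + h i := by
  obtain ⟨b, hb, hb'⟩ := hg
  obtain ⟨c, hc, hc'⟩ := hh
  refine ⟨fun k => b k + c k, hb.add hc, fun i k => ?_⟩
  rw [map_add]
  exact (abs_add_le _ _).trans (add_le_add (hb' i k) (hc' i k))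

theorem Dom.neg {h : ι → ℝ⟦X⟧} (hh : Dom h) : Dom fun i => -h i := by
  obtain ⟨c, hc, hc'⟩ := hh
  exact ⟨c, hc, fun i k => by rw [map_neg, abs_neg]; exact hc' i k⟩

theorem Dom.sub {g h : ι → ℝ⟦X⟧} (hg : Dom g) (hh : Dom h) : Dom fun i => g i - h i := by
  simpa only [sub_eq_add_neg] using hg.add hh.neg

theorem Dom.mul {g h : ι → ℝ⟦X⟧} (hg : Dom g) (hh : Dom h) : Dom fun i => g i * h i := by
  obtain ⟨b, hb, hb'⟩ := hg
  obtain ⟨c, hc, hc'⟩ := hh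
  rcases isEmpty_or_nonempty ι with hι | ⟨⟨i₀⟩⟩
  · exact ⟨0, summable_zero, fun i => (IsEmpty.false i).elim⟩
  have hb0 : ∀ k, 0 ≤ b k := fun k => (abs_nonneg _).trans (hb' i₀ k)
  have hc0 : ∀ k, 0 ≤ c k := fun k => (abs_nonneg _).trans (hc' i₀ k)
  refine ⟨fun n => ∑ kl ∈ Finset.HasAntidiagonal.antidiagonal n, b kl.1 * c kl.2,
    summable_sum_mul_antidiagonal_of_summable_mul (hb.mul_of_nonneg hc hb0 hc0), fun i k => ?_⟩
  rw [PowerSeries.coeff_mul]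
  refine (Finset.abs_sum_le_sum_abs _ _).trans (Finset.sum_le_sum fun p _ => ?_)
  rw [abs_mul]
  exact mul_le_mul (hb' i _) (hc' i _) (abs_nonneg _) (hb0 _)

theorem Dom.of_bounded {h : ι → ℝ⟦X⟧} (N : ℕ) (M : ℝ) (hM : ∀ i k, |coeff k (h i)| ≤ M)
    (hN : ∀ i k, N ≤ k → coeff k (h i) = 0) : Dom h := by
  refine ⟨fun k => if k < N then M else 0, summable_of_ne_finset_zero (s := Finset.range N) ?_, ?_⟩
  · intro k hk; rw [if_neg (by simpa using hk)]
  · intro i k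
    by_cases hk : k < N
    · simpa [hk] using hM i k
    · simp only [hk, if_false]
      rw [hN i k (by omega), abs_zero]

theorem Dom.X_pow (k : ℕ) : Dom fun _ : ι => (PowerSeries.X : ℝ⟦X⟧) ^ k := by
  refine Dom.of_bounded (k + 1) 1 (fun _ j => ?_) fun _ j hj => ?_
  · rw [PowerSeries.coeff_X_pow]; split_ifs <;> simp
  · rw [PowerSeries.coeff_X_pow, if_neg (by omega)]

theorem BddPow.add {f g : ι → ℝ⟦X⟧} (hf : BddPow f) (hg : BddPow g) :
    BddPow fun i => f i + g i := by
  obtain ⟨C, hC⟩ := hf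
  obtain ⟨D, hD⟩ := hg
  exact ⟨2 * C + 2 * D, fun n i => by linarith [corr_add_self_le n (f i) (g i), hC n i, hD n i]⟩

theorem BddPow.mul {h f : ι → ℝ⟦X⟧} (hh : Dom h) (hf : BddPow f) : BddPow fun i => h i * f i := by
  obtain ⟨b, hb, hb'⟩ := hh
  obtain ⟨C, hC⟩ := hf
  refine ⟨(∑' k, b k) ^ 2 * C, fun n i => (corr_mul_self_le n _ _).trans ?_⟩
  have : ∑ k ∈ Finset.range (n + 1), |coeff k (h i)| ≤ ∑' k, b k :=
    (Finset.sum_le_sum fun k _ => hb' i k).trans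
      (hb.sum_le_tsum _ fun k _ => (abs_nonneg _).trans (hb' i k))
  have h0 := corr_self_nonneg n (f i)
  gcongr
  exact hC n i

theorem BddPow.comp {κ : Type*} {f : ι → ℝ⟦X⟧} (hf : BddPow f) (e : κ → ι) :
    BddPow fun i => f (e i) := by
  obtain ⟨C, hC⟩ := hf
  exact ⟨C, fun n i => hC n _⟩

theorem BddPow.X_pow_mul {f : ι → ℝ⟦X⟧} (hf : BddPow f) (k : ℕ) :
    BddPow fun i => PowerSeries.X ^ k * f i := hf.mul (Dom.X_pow k)

theorem BddPow.had {f : ι → ℝ⟦X⟧} (hf : BddPow f) {a : ι → ℝ⟦X⟧}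
    (ha : ∀ i k, |coeff k (a i)| ≤ 1) : BddPow fun i => had (a i) (f i) := by
  obtain ⟨C, hC⟩ := hf
  refine ⟨C, fun n i => le_trans ?_ (hC n i)⟩
  refine div_le_div_of_nonneg_right (Finset.sum_le_sum fun t _ => ?_) n.cast_nonneg
  rw [coeff_had, mul_mul_mul_comm]
  exact mul_le_of_le_one_left (mul_self_nonneg _)
    (by nlinarith [abs_le.1 (ha i t)])

theorem tendsto_reindex {κ : Type*} (r : κ → ι) :
    Tendsto (fun p : ℕ × κ => (p.1, r p.2)) (atTop ×ˢ (⊤ : Filter κ))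
      (atTop ×ˢ (⊤ : Filter ι)) := by
  have h : Tendsto (fun p : ℕ × κ => r p.2) (atTop ×ˢ (⊤ : Filter κ)) ⊤ := tendsto_top
  exact Tendsto.prodMk tendsto_fst h

theorem tendsto_comp_reindex {κ : Type*} {F : ℕ × ι → ℝ}
    (h : Tendsto F (atTop ×ˢ ⊤) (𝓝 0)) (r : κ → ι) :
    Tendsto (fun p : ℕ × κ => F (p.1, r p.2)) (atTop ×ˢ ⊤) (𝓝 0) := h.comp (tendsto_reindex r)

theorem Uncorr.comp {κ : Type*} {f g : ι → ℝ⟦X⟧} (h : Uncorr f g) (r : κ → ι) :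
    Uncorr (fun i => f (r i)) fun i => g (r i) := tendsto_comp_reindex h r

theorem Uncorr.symm {f g : ι → ℝ⟦X⟧} (h : Uncorr f g) : Uncorr g f := by
  simpa only [Uncorr, corr_comm] using h

theorem Uncorr.add_right {f g h : ι → ℝ⟦X⟧} (hg : Uncorr f g) (hh : Uncorr f h) :
    Uncorr f fun i => g i + h i := by
  simpa only [Uncorr, corr_add_right, add_zero] using Tendsto.add hg hh

theorem Uncorr.sub_right {f g h : ι → ℝ⟦X⟧} (hg : Uncorr f g) (hh : Uncorr f h) :
    Uncorr f fun i => g i - h i := by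
  simpa only [Uncorr, corr_sub_right, sub_zero] using Tendsto.sub hg hh

theorem uncorr_const {f g : ℝ⟦X⟧} (h : Tendsto (fun n => corr n f g) atTop (𝓝 0)) :
    Uncorr (fun _ : ι => f) fun _ => g := h.comp tendsto_fst

/-- If two families are asymptotically uncorrelated at all lags, this remains true after one of
them passes through a dominated family of filters; only lags at which some of the filters do not
vanish matter. -/
theorem Uncorr.mul_right {a h f : ι → ℝ⟦X⟧} (hh : Dom h) (ha : BddPow a) (hf : BddPow f)
    (haf : ∀ k, (∃ i, coeff k (h i) ≠ 0) → Uncorr a fun i => PowerSeries.X ^ k * f i) :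
    Uncorr a fun i => h i * f i := by
  classical
  obtain ⟨b, hb, hb'⟩ := hh
  obtain ⟨C, hC⟩ := ha
  obtain ⟨D, hD⟩ := hf
  rcases isEmpty_or_nonempty ι with hι | ⟨⟨i₀⟩⟩
  · exact tendsto_of_isEmpty
  have hb0 : ∀ k, 0 ≤ b k := fun k => (abs_nonneg _).trans (hb' i₀ k)
  have hbd : ∀ n i k, |corr n (a i) (PowerSeries.X ^ k * f i)| ≤ (C + D) / 2 := fun n i k => by
    linarith [abs_corr_le n (a i) (PowerSeries.X ^ k * f i), hC n i, hD n i,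
      corr_X_pow_mul_self_le n k (f i)]
  set F : ℕ × ι → ℕ → ℝ := fun p k =>
    |coeff k (h p.2)| * |corr p.1 (a p.2) (PowerSeries.X ^ k * f p.2)| with hF
  have hF0 : ∀ p k, 0 ≤ F p k := fun p k => mul_nonneg (abs_nonneg _) (abs_nonneg _)
  have hFb : ∀ p k, F p k ≤ b k * ((C + D) / 2) := fun p k =>
    mul_le_mul (hb' _ k) (hbd _ _ _) (abs_nonneg _) (hb0 k)
  -- Tannery's theorem over the lags: each term tends to zero uniformly in the index, and `b k * ((C
  -- + D) / 2)` is a summable majorant. A lag at which every filter vanishes contributes nothing.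
  have key : Tendsto (fun p : ℕ × ι => ∑' k, F p k) (atTop ×ˢ ⊤) (𝓝 (∑' _ : ℕ, (0 : ℝ))) := by
    refine tendsto_tsum_of_dominated_convergence (bound := fun k => b k * ((C + D) / 2))
      (hb.mul_right _) (fun k => ?_) (Eventually.of_forall fun p k => ?_)
    · by_cases hk : ∃ i, coeff k (h i) ≠ 0
      · have h1 := (Tendsto.abs (haf k hk)).const_mul (b k)
        rw [abs_zero, mul_zero] at h1
        exact squeeze_zero (fun p => hF0 p k)
          (fun p => mul_le_mul_of_nonneg_right (hb' _ k) (abs_nonneg _)) h1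
      · push Not at hk
        simpa [hF, hk] using tendsto_const_nhds
    · rw [Real.norm_of_nonneg (hF0 p k)]
      exact hFb p k
  rw [tsum_zero] at key
  refine squeeze_zero_norm (fun p => ?_) key
  rw [corr_mul_eq_sum, Real.norm_eq_abs]
  refine (Finset.abs_sum_le_sum_abs _ _).trans ?_
  simp only [abs_mul]
  exact Summable.sum_le_tsum (Finset.range (p.1 + 1)) (fun k _ => hF0 p k)
    (Summable.of_nonneg_of_le (hF0 p) (hFb p) (hb.mul_right _))

/-- A common delay preserves convergence of the sample correlations to `0`. -/
theorem Uncorr.X_pow_mul {f g : ι → ℝ⟦X⟧} (h : Uncorr f g) (k : ℕ) :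
    Uncorr (fun i => PowerSeries.X ^ k * f i) fun i => PowerSeries.X ^ k * g i := by
  have hs : Tendsto (fun p : ℕ × ι => (p.1 - k, p.2)) (atTop ×ˢ ⊤) (atTop ×ˢ ⊤) :=
    (tendsto_sub_atTop_nat k).prodMap tendsto_id
  have h1 := (Tendsto.comp h hs).abs
  rw [abs_zero] at h1
  refine squeeze_zero_norm' ?_ h1
  have h2 : ∀ᶠ p : ℕ × ι in atTop ×ˢ ⊤, k < p.1 :=
    tendsto_fst.eventually (eventually_gt_atTop k)
  filter_upwards [h2] with p hp
  obtain ⟨m, hm⟩ := Nat.exists_eq_add_of_lt hp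
  rw [show p.1 = (m + 1) + k by omega, corr_X_pow_mul (by omega), Real.norm_eq_abs, abs_mul]
  simp only [Function.comp, show p.1 - k = m + 1 by omega]
  refine mul_le_of_le_one_left (abs_nonneg _) ?_
  rw [abs_of_nonneg (by positivity)]
  exact div_le_one_of_le₀ (by push_cast; linarith [(Nat.cast_nonneg k : (0 : ℝ) ≤ k)]) (by positivity)

end SPS

namespace SPS

open scoped PowerSeries
open PowerSeries (coeff)

variable {na nb : ℕ}

/-! ### ARX systems as identities between power series -/

theorem coeff_polyA (θ : Param na nb) (k : ℕ) :
    (polyA θ).coeff k = (if k = 0 then 1 else 0)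
      + ∑ j : Fin na, if k = (j : ℕ) + 1 then θ (Sum.inl j) else 0 := by
  simp [polyA, Polynomial.coeff_one, Polynomial.finsetSum_coeff]

theorem coeff_polyB (θ : Param na nb) (k : ℕ) :
    (polyB θ).coeff k = ∑ j : Fin nb, if k = (j : ℕ) + 1 then θ (Sum.inr j) else 0 := by
  simp [polyB, Polynomial.finsetSum_coeff]

theorem coeff_polyA_zero (θ : Param na nb) : (polyA θ).coeff 0 = 1 := by
  simp [coeff_polyA]

theorem coeff_polyB_zero (θ : Param na nb) : (polyB θ).coeff 0 = 0 := by
  simp [coeff_polyB]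

theorem coeff_polyA_succ (θ : Param na nb) (j : Fin na) :
    (polyA θ).coeff (j + 1) = θ (Sum.inl j) := by
  simp [coeff_polyA, Fin.val_inj]

theorem coeff_polyB_succ (θ : Param na nb) (j : Fin nb) :
    (polyB θ).coeff (j + 1) = θ (Sum.inr j) := by
  simp [coeff_polyB, Fin.val_inj]

theorem natDegree_polyA_le (θ : Param na nb) : (polyA θ).natDegree ≤ na := by
  rw [Polynomial.natDegree_le_iff_coeff_eq_zero]
  intro k hk
  rw [coeff_polyA, if_neg (by omega), zero_add]
  exact Finset.sum_eq_zero fun j _ => if_neg (by omega)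

theorem natDegree_polyB_le (θ : Param na nb) : (polyB θ).natDegree ≤ nb := by
  rw [Polynomial.natDegree_le_iff_coeff_eq_zero]
  intro k hk
  rw [coeff_polyB]
  exact Finset.sum_eq_zero fun j _ => if_neg (by omega)

theorem continuous_coeff_polyA (k : ℕ) :
    Continuous fun θ : Param na nb => (polyA θ).coeff k := by
  simp only [coeff_polyA]
  refine continuous_const.add (continuous_finsetSum _ fun j _ => ?_)
  split_ifs <;> fun_prop

theorem continuous_coeff_polyB (k : ℕ) :
    Continuous fun θ : Param na nb => (polyB θ).coeff k := by
  simp only [coeff_polyB]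
  refine continuous_finsetSum _ fun j _ => ?_
  split_ifs <;> fun_prop

theorem polyA_sub (θ η : Param na nb) : polyA (θ - η) - 1 = polyA θ - polyA η := by
  simp [polyA, sub_mul, Finset.sum_sub_distrib]

theorem polyB_sub (θ η : Param na nb) : polyB (θ - η) = polyB θ - polyB η := by
  simp [polyB, sub_mul, Finset.sum_sub_distrib]

/-- The signal `∑_k l_{b,k} u_{t-k} - ∑_k l_{a,k} y_{t-k}`, i.e. the regressor times `l`. -/
def linReg (l : Param na nb) (y u : ℝ⟦X⟧) : ℝ⟦X⟧ :=
  (polyB l : ℝ⟦X⟧) * u - ((polyA l - 1 : ℝ[X]) : ℝ⟦X⟧) * y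

theorem coeff_linReg (l : Param na nb) (y u : ℕ → ℝ) (t : ℕ) :
    coeff t (linReg l (sig y) (sig u)) = ∑ j, regressor na nb y u t j * l j := by
  have hA : ((polyA l - 1 : ℝ[X]) : ℝ⟦X⟧)
      = ∑ k : Fin na, PowerSeries.C (l (Sum.inl k)) * PowerSeries.X ^ ((k : ℕ) + 1) := by
    rw [polyA, add_sub_cancel_left]
    simp only [← Polynomial.coeToPowerSeries.ringHom_apply, map_sum, map_mul, map_pow]
    simp
  have hB : (polyB l : ℝ⟦X⟧)
      = ∑ k : Fin nb, PowerSeries.C (l (Sum.inr k)) * PowerSeries.X ^ ((k : ℕ) + 1) := by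
    rw [polyB]
    simp only [← Polynomial.coeToPowerSeries.ringHom_apply, map_sum, map_mul, map_pow]
    simp
  rw [linReg, hA, hB, Fintype.sum_sum_type, Finset.sum_mul, Finset.sum_mul, map_sub, map_sum,
    map_sum, sub_eq_add_neg, add_comm, ← Finset.sum_neg_distrib]
  simp only [mul_assoc, PowerSeries.coeff_C_mul, coeff_X_pow_mul_sig, regressor, Sum.elim_inl,
    Sum.elim_inr]
  congr 1 <;> exact Finset.sum_congr rfl fun k _ => by ring

theorem polyA_mul_sig_arxOutput (θ : Param na nb) (u e : ℕ → ℝ) :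
    (polyA θ : ℝ⟦X⟧) * sig (arxOutput θ u e) = (polyB θ : ℝ⟦X⟧) * sig u + sig e := by
  have h : sig (arxOutput θ u e) = linReg θ (sig (arxOutput θ u e)) (sig u) + sig e := by
    ext t
    rw [map_add, coeff_linReg]
    rcases Nat.eq_zero_or_pos t with rfl | ht
    · simp [coeff_sig_zero, regressor, delayed]
    · rw [coeff_sig _ ht.ne', coeff_sig _ ht.ne', arxOutput_eq θ u e ht]
  rw [linReg] at h
  have h1 : ((polyA θ - 1 : ℝ[X]) : ℝ⟦X⟧) = (polyA θ : ℝ⟦X⟧) - 1 := by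
    simp [← Polynomial.coeToPowerSeries.ringHom_apply]
  rw [h1] at h
  linear_combination h

theorem sig_predError (y u : ℕ → ℝ) (θ : Param na nb) :
    sig (predError y u θ) = (polyA θ : ℝ⟦X⟧) * sig y - (polyB θ : ℝ⟦X⟧) * sig u := by
  have h : sig (predError y u θ) = sig y - linReg θ (sig y) (sig u) := by
    ext t
    rw [map_sub, coeff_linReg]
    rcases Nat.eq_zero_or_pos t with rfl | ht
    · simp [coeff_sig_zero, regressor, delayed]
    · rw [coeff_sig _ ht.ne', coeff_sig _ ht.ne', predError]
  have h1 : ((polyA θ - 1 : ℝ[X]) : ℝ⟦X⟧) = (polyA θ : ℝ⟦X⟧) - 1 := by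
    simp [← Polynomial.coeToPowerSeries.ringHom_apply]
  rw [h, linReg, h1]
  ring

theorem sig_mul (s x : ℕ → ℝ) : sig (fun t => s t * x t) = had (sig s) (sig x) := by
  ext t
  rcases Nat.eq_zero_or_pos t with rfl | ht
  · simp [coeff_sig_zero, coeff_had]
  · simp [coeff_had, coeff_sig _ ht.ne']

theorem constantCoeff_polyA (θ : Param na nb) :
    PowerSeries.constantCoeff (polyA θ : ℝ⟦X⟧) ≠ 0 := by
  rw [← PowerSeries.coeff_zero_eq_constantCoeff_apply, Polynomial.coeff_coe, coeff_polyA_zero]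
  exact one_ne_zero

theorem sum_Icc_eq_sum_range {f : ℕ → ℝ} (h0 : f 0 = 0) (n : ℕ) :
    ∑ t ∈ Finset.Icc 1 n, f t = ∑ t ∈ Finset.range (n + 1), f t := by
  refine Finset.sum_subset (fun t ht => ?_) fun t ht ht' => ?_
  · have := Finset.mem_Icc.1 ht
    exact Finset.mem_range.2 (by omega)
  · have := Finset.mem_range.1 ht
    have : t = 0 := by by_contra h; exact ht' (Finset.mem_Icc.2 (by omega))
    rw [this, h0]

theorem corr_sig_linReg (l : Param na nb) (y u ε : ℕ → ℝ) (n : ℕ) :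
    ((n : ℝ)⁻¹ • ∑ t ∈ Finset.Icc 1 n, ε t • regressor na nb y u t) ⬝ᵥ (l : _ → ℝ)
      = corr n (sig ε) (linReg l (sig y) (sig u)) := by
  rw [smul_dotProduct, sum_dotProduct, corr, smul_eq_mul, inv_mul_eq_div]
  congr 1
  rw [← sum_Icc_eq_sum_range (by rw [coeff_sig_zero, zero_mul])]
  refine Finset.sum_congr rfl fun t ht => ?_
  rw [coeff_sig _ (by have := Finset.mem_Icc.1 ht; omega), coeff_linReg, smul_dotProduct,
    smul_eq_mul, dotProduct]

theorem dotProduct_sampleCov (l : Param na nb) (y u : ℕ → ℝ) (n : ℕ) :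
    (l : _ → ℝ) ⬝ᵥ (sampleCov (regressor na nb y u) n *ᵥ (l : _ → ℝ))
      = corr n (linReg l (sig y) (sig u)) (linReg l (sig y) (sig u)) := by
  rw [sampleCov, Matrix.smul_mulVec, Matrix.sum_mulVec, dotProduct_smul, dotProduct_sum, corr,
    smul_eq_mul, inv_mul_eq_div]
  congr 1
  rw [← sum_Icc_eq_sum_range (by simp [coeff_linReg, regressor, delayed])]
  refine Finset.sum_congr rfl fun t ht => ?_
  rw [coeff_linReg, Matrix.vecMulVec_mulVec, dotProduct_smul, dotProduct_comm l.ofLp]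
  rfl

/-! ### The polynomial `B(l) A(θ) - (A(l) - 1) B(θ)` -/

/-- The input filter of `A(z⁻¹; θ)` times the regressor times `l`. -/
def crossPoly (θ l : Param na nb) : ℝ[X] := polyB l * polyA θ - (polyA l - 1) * polyB θ

/-- Filtering with `A(θ)` eliminates the output, so the regressor in direction `l` becomes
finite-length filters of the input and of the driving noise. Undoing the filter costs only a
constant, by `corr_mul_self_le`. -/
theorem polyA_mul_linReg {θ : Param na nb} {y u e : ℝ⟦X⟧}
    (h : (polyA θ : ℝ⟦X⟧) * y = (polyB θ : ℝ⟦X⟧) * u + e) (l : Param na nb) :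
    (polyA θ : ℝ⟦X⟧) * linReg l y u
      = (crossPoly θ l : ℝ⟦X⟧) * u - ((polyA l - 1 : ℝ[X]) : ℝ⟦X⟧) * e := by
  simp only [linReg, crossPoly, Polynomial.coe_sub, Polynomial.coe_mul, Polynomial.coe_one]
  linear_combination (1 - (polyA l : ℝ⟦X⟧)) * h

theorem coeff_crossPoly_zero (θ l : Param na nb) : (crossPoly θ l).coeff 0 = 0 := by
  simp [crossPoly, Polynomial.mul_coeff_zero, coeff_polyB_zero]

theorem natDegree_polyA_sub_one_le (l : Param na nb) : (polyA l - 1).natDegree ≤ na :=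
  (Polynomial.natDegree_sub_le _ _).trans (by simp [natDegree_polyA_le])

theorem coeff_crossPoly_eq_zero (θ l : Param na nb) {k : ℕ} (hk : na + nb < k) :
    (crossPoly θ l).coeff k = 0 := by
  refine Polynomial.coeff_eq_zero_of_natDegree_lt (lt_of_le_of_lt ?_ hk)
  refine (Polynomial.natDegree_sub_le _ _).trans (max_le ?_ ?_)
  · exact Polynomial.natDegree_mul_le.trans
      (by linarith [natDegree_polyB_le l, natDegree_polyA_le θ])
  · exact Polynomial.natDegree_mul_le.trans
      (by linarith [natDegree_polyA_sub_one_le l, natDegree_polyB_le θ])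

theorem continuous_coeff_polyA_sub_one (k : ℕ) :
    Continuous fun l : Param na nb => (polyA l - 1).coeff k := by
  simp only [Polynomial.coeff_sub]
  exact (continuous_coeff_polyA k).sub continuous_const

theorem continuous_coeff_crossPoly (k : ℕ) :
    Continuous fun x : Param na nb × Param na nb => (crossPoly x.1 x.2).coeff k := by
  simp only [crossPoly, Polynomial.coeff_sub (_ * _), Polynomial.coeff_mul]
  refine (continuous_finsetSum _ fun j _ => ?_).sub (continuous_finsetSum _ fun j _ => ?_)
  · exact ((continuous_coeff_polyB _).comp continuous_snd).mul
      ((continuous_coeff_polyA _).comp continuous_fst)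
  · exact ((continuous_coeff_polyA_sub_one _).comp continuous_snd).mul
      ((continuous_coeff_polyB _).comp continuous_fst)

theorem eq_zero_of_polyB_eq_zero {l : Param na nb} (hA : ∀ k, l (Sum.inl k) = 0)
    (hB : polyB l = 0) : l = 0 := by
  ext (j | j)
  · exact hA j
  · simpa [hB] using (coeff_polyB_succ l j).symm

/-- Without an autoregressive part in `l`, the polynomial is `B(l) A(θ)`, and `A(θ) ≠ 0` since its
constant term is `1`. Hence, for any `θ`, the input can fail to excite only directions in which the
noise acts. -/
theorem eq_zero_of_crossPoly_eq_zero {θ l : Param na nb} (hA : ∀ k, l (Sum.inl k) = 0)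
    (h : crossPoly θ l = 0) : l = 0 := by
  have hA' : polyA l - 1 = 0 := by simp [polyA, hA]
  have hA0 : polyA θ ≠ 0 := fun h0 => by simpa [h0] using coeff_polyA_zero θ
  rw [crossPoly, hA', zero_mul, sub_zero, mul_eq_zero] at h
  exact eq_zero_of_polyB_eq_zero hA (h.resolve_right hA0)

/-- For coprime polynomials of which at least one has the full order, the linear map
`l ↦ B(l) A(θ) - (A(l) - 1) B(θ)` is injective. -/
theorem eq_zero_of_crossPoly_eq_zero_of_isCoprime {θ l : Param na nb}
    (horders : (polyA θ).coeff na ≠ 0 ∨ (polyB θ).coeff nb ≠ 0)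
    (hcop : IsCoprime (polyA θ) (polyB θ)) (h : crossPoly θ l = 0) : l = 0 := by
  have hA0 : polyA θ ≠ 0 := fun h0 => by simpa [h0] using coeff_polyA_zero θ
  rw [crossPoly, sub_eq_zero] at h
  have hP0 : (polyA l - 1).coeff 0 = 0 := by simp [coeff_polyA_zero]
  suffices hP : polyA l - 1 = 0 by
    refine eq_zero_of_crossPoly_eq_zero (θ := θ) (fun k => ?_) (by rw [crossPoly, h, sub_self])
    have h1 := congrArg (Polynomial.coeff · ((k : ℕ) + 1)) hP
    simpa [Polynomial.coeff_one, coeff_polyA_succ] using h1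
  -- Coprimeness gives a divisibility, and the factor of full order forces the quotient to be
  -- constant. The constant terms `0` of `A(l) - 1` and `1` of `A(θ)` then make that constant zero.
  suffices hc : ∃ c : ℝ, polyA l - 1 = Polynomial.C c * polyA θ by
    obtain ⟨c, hc⟩ := hc
    rw [hc, Polynomial.coeff_C_mul, coeff_polyA_zero, mul_one] at hP0
    rw [hc, hP0, Polynomial.C_0, zero_mul]
  rcases horders with ha | hb
  · have hdvd : polyA θ ∣ polyA l - 1 :=
      hcop.dvd_of_dvd_mul_right ⟨polyB l, by rw [← h, mul_comm]⟩
    obtain ⟨r, hr⟩ := hdvd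
    have hdeg : (polyA θ).natDegree = na :=
      le_antisymm (natDegree_polyA_le θ) (Polynomial.le_natDegree_of_ne_zero ha)
    rcases eq_or_ne r 0 with rfl | hr0
    · exact ⟨0, by simp [hr]⟩
    have hrd : r.natDegree = 0 := by
      have h1 := natDegree_polyA_sub_one_le l
      rw [hr, Polynomial.natDegree_mul hA0 hr0, hdeg] at h1
      omega
    rw [Polynomial.natDegree_eq_zero] at hrd
    obtain ⟨c, rfl⟩ := hrd
    exact ⟨c, by rw [hr, mul_comm]⟩
  · have hB0 : polyB θ ≠ 0 := fun h0 => by simp [h0] at hb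
    have hdvd : polyB θ ∣ polyB l := hcop.symm.dvd_of_dvd_mul_right ⟨polyA l - 1, by rw [h, mul_comm]⟩
    obtain ⟨r, hr⟩ := hdvd
    have hdeg : (polyB θ).natDegree = nb :=
      le_antisymm (natDegree_polyB_le θ) (Polynomial.le_natDegree_of_ne_zero hb)
    have hrA : polyA l - 1 = r * polyA θ := by
      refine mul_right_cancel₀ hB0 ?_
      rw [← h, hr]; ring
    rcases eq_or_ne r 0 with rfl | hr0
    · exact ⟨0, by simp [hrA]⟩
    have hrd : r.natDegree = 0 := by
      have h1 := natDegree_polyB_le l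
      rw [hr, Polynomial.natDegree_mul hB0 hr0, hdeg] at h1
      omega
    rw [Polynomial.natDegree_eq_zero] at hrd
    obtain ⟨c, rfl⟩ := hrd
    exact ⟨c, hrA⟩

/-- A family of polynomials of bounded degree whose coefficients depend continuously on a parameter
in a compact set is dominated. -/
theorem Dom.of_isCompact {ι Z : Type*} [TopologicalSpace Z] {K : Set Z} (hK : IsCompact K)
    {p : Z → ℝ[X]} (hp : ∀ k, Continuous fun x => (p x).coeff k) (d : ℕ)
    (hd : ∀ x, (p x).natDegree ≤ d) {z : ι → Z} (hz : ∀ i, z i ∈ K) :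
    Dom fun i => (p (z i) : ℝ⟦X⟧) := by
  choose C hC using fun k => hK.exists_bound_of_continuousOn (hp k).continuousOn
  refine ⟨fun k => if k ≤ d then C k else 0,
    summable_of_ne_finset_zero (s := Finset.range (d + 1)) ?_, fun i k => ?_⟩
  · intro k hk; rw [if_neg (by simpa [Nat.lt_succ_iff] using hk)]
  · rw [Polynomial.coeff_coe]
    by_cases hk : k ≤ d
    · simpa [hk] using hC k (z i) (hz i)
    · simp only [hk, if_false]
      rw [Polynomial.coeff_eq_zero_of_natDegree_lt (by linarith [hd (z i)]), abs_zero]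

end SPS

namespace SPS

open scoped PowerSeries
open PowerSeries (coeff)

variable {na nb : ℕ}

/-! ### Persistent excitation -/

theorem tendsto_corr_X_pow_mul {f g : ℝ⟦X⟧} {c : ℝ}
    (h : Tendsto (fun n => corr n f g) atTop (𝓝 c)) (k : ℕ) :
    Tendsto (fun n => corr n (PowerSeries.X ^ k * f) (PowerSeries.X ^ k * g)) atTop (𝓝 c) := by
  rw [← tendsto_add_atTop_iff_nat k]
  have h1 : Tendsto (fun n : ℕ => (n : ℝ) / (n + k : ℕ) * corr n f g) atTop (𝓝 (1 * c)) := by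
    refine Tendsto.mul ?_ h
    simpa using tendsto_natCast_div_add_atTop (k : ℝ)
  rw [one_mul] at h1
  refine h1.congr' ?_
  filter_upwards [eventually_ne_atTop 0] with n hn
  rw [corr_X_pow_mul hn]

/-- The uncentred sample autocovariances of a persistently exciting input converge, and their
Toeplitz form is positive definite. -/
theorem PersistentlyExciting.exists_limits {u : ℕ → ℝ} {r : ℕ} (h : PersistentlyExciting u r) :
    ∃ ρ : ℕ → ℝ,
      (∀ i j : ℕ, Tendsto (fun n => corr n (PowerSeries.X ^ i * sig u) (PowerSeries.X ^ j * sig u))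
        atTop (𝓝 (ρ ((i : ℤ) - (j : ℤ)).natAbs))) ∧
      ∀ x : Fin r → ℝ, x ≠ 0 →
        0 < ∑ i, ∑ j, x i * x j * ρ ((i : ℤ) - (j : ℤ)).natAbs := by
  obtain ⟨m, c, hm, hc, hT⟩ := h
  have hone : Tendsto (fun n : ℕ => (∑ t ∈ Finset.Icc 1 n, (1 : ℝ)) / n) atTop (𝓝 1) := by
    refine tendsto_const_nhds.congr' ?_
    filter_upwards [eventually_ne_atTop 0] with n hn
    simp [hn]
  have hmk : ∀ k, Tendsto (fun n : ℕ => (∑ t ∈ Finset.Icc 1 n, delayed u t k) / n)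
      atTop (𝓝 m) := by
    intro k
    have h0 : Tendsto (fun n => corr n (PowerSeries.mk fun _ => (1 : ℝ)) (sig u)) atTop (𝓝 m) := by
      refine hm.congr fun n => ?_
      rw [corr, ← sum_Icc_eq_sum_range (by rw [coeff_sig_zero, mul_zero])]
      congr 1
      refine Finset.sum_congr rfl fun t ht => ?_
      rw [coeff_sig _ (by have := Finset.mem_Icc.1 ht; omega)]
      simp
    refine (tendsto_corr_X_pow_mul h0 k).congr fun n => ?_
    rw [corr, ← sum_Icc_eq_sum_range (by rw [coeff_X_pow_mul_sig]; simp [delayed])]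
    congr 1
    refine Finset.sum_congr rfl fun t ht => ?_
    rw [coeff_X_pow_mul_sig, PowerSeries.coeff_X_pow_mul']
    by_cases hk : k ≤ t
    · simp [hk]
    · simp [hk, delayed, show ¬ k < t by omega]
  have hlag : ∀ k, Tendsto (fun n => corr n (sig u) (PowerSeries.X ^ k * sig u)) atTop
      (𝓝 (c k + m ^ 2)) := by
    intro k
    -- Termwise, `u v = (u - m)(v - m) + m u + m v - m²`.
    have h1 := ((hc k).add (((hm.const_mul m).add ((hmk k).const_mul m)))).sub
      (hone.const_mul (m ^ 2))
    rw [show c k + (m * m + m * m) - m ^ 2 * 1 = c k + m ^ 2 by ring] at h1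
    refine h1.congr fun n => ?_
    rw [corr, ← sum_Icc_eq_sum_range (by rw [coeff_sig_zero, zero_mul])]
    simp only [← mul_div_assoc, ← add_div, ← sub_div, Finset.mul_sum, ← Finset.sum_add_distrib,
      ← Finset.sum_sub_distrib]
    congr 1
    refine Finset.sum_congr rfl fun t ht => ?_
    rw [coeff_X_pow_mul_sig, coeff_sig _ (by have := Finset.mem_Icc.1 ht; omega)]
    ring
  have hle : ∀ i k, Tendsto (fun n => corr n (PowerSeries.X ^ i * sig u)
      (PowerSeries.X ^ (i + k) * sig u)) atTop (𝓝 (c k + m ^ 2)) := by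
    intro i k
    simpa only [pow_add, mul_assoc] using tendsto_corr_X_pow_mul (hlag k) i
  refine ⟨fun k => c k + m ^ 2, fun i j => ?_, fun x hx => ?_⟩
  · rcases le_total i j with hij | hij
    · obtain ⟨k, rfl⟩ := Nat.exists_eq_add_of_le hij
      rw [show ((i : ℤ) - ((i + k : ℕ) : ℤ)).natAbs = k by omega]
      exact hle i k
    · obtain ⟨k, rfl⟩ := Nat.exists_eq_add_of_le hij
      rw [show (((j + k : ℕ) : ℤ) - (j : ℤ)).natAbs = k by omega]
      simpa only [corr_comm] using hle j k
  · have h1 : 0 < ∑ i, ∑ j, x i * x j * c ((i : ℤ) - (j : ℤ)).natAbs := by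
      have := hT.dotProduct_mulVec_pos hx
      simp only [dotProduct, Matrix.mulVec, Matrix.of_apply, Finset.mul_sum, Pi.star_apply,
        star_trivial] at this
      refine this.trans_eq (Finset.sum_congr rfl fun i _ => Finset.sum_congr rfl fun j _ => by ring)
    -- Dropping the centring adds the rank-one form `m² (∑ x_i)² ≥ 0`, so positive definiteness
    -- survives.
    have h2 : ∑ i, ∑ j, x i * x j * (c ((i : ℤ) - (j : ℤ)).natAbs + m ^ 2)
        = ∑ i, ∑ j, x i * x j * c ((i : ℤ) - (j : ℤ)).natAbs + m ^ 2 * (∑ i, x i) ^ 2 := by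
      rw [pow_two (∑ i, x i), Finset.sum_mul_sum]
      simp only [mul_add, Finset.sum_add_distrib, Finset.mul_sum]
      congr 1
      exact Finset.sum_congr rfl fun i _ => Finset.sum_congr rfl fun j _ => by ring
    rw [h2]
    positivity

theorem corr_smul_right (n : ℕ) (a : ℝ) (f g : ℝ⟦X⟧) :
    corr n f (PowerSeries.C a * g) = a * corr n f g := by
  simp only [corr, PowerSeries.coeff_C_mul, ← mul_div_assoc, Finset.mul_sum]
  congr 1
  exact Finset.sum_congr rfl fun t _ => by ring

theorem corr_sum_right {κ : Type*} (s : Finset κ) (n : ℕ) (f : ℝ⟦X⟧) (g : κ → ℝ⟦X⟧) :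
    corr n f (∑ i ∈ s, g i) = ∑ i ∈ s, corr n f (g i) := by
  simp only [corr, map_sum, Finset.mul_sum, ← Finset.sum_div]
  rw [Finset.sum_comm]

theorem coe_eq_sum {p : ℝ[X]} {r : ℕ} (h0 : p.coeff 0 = 0) (hr : ∀ k, r < k → p.coeff k = 0) :
    (p : ℝ⟦X⟧) = ∑ i : Fin r, PowerSeries.C (p.coeff (i + 1)) * PowerSeries.X ^ ((i : ℕ) + 1) := by
  ext k
  rw [Polynomial.coeff_coe, map_sum]
  simp only [PowerSeries.coeff_C_mul_X_pow]
  rcases k with _ | k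
  · simp [h0]
  by_cases hk : k < r
  · rw [Finset.sum_eq_single ⟨k, hk⟩]
    · simp
    · intro j _ hj
      rw [if_neg]
      intro h
      exact hj (Fin.ext (by simp; omega))
    · simp
  · rw [hr _ (by omega), Finset.sum_eq_zero]
    intro j _
    rw [if_neg (by omega)]

/-- The power of a filtered signal as a quadratic form in the coefficients of the filter. -/
theorem corr_polynomial_mul {p : ℝ[X]} {r : ℕ} (h0 : p.coeff 0 = 0)
    (hr : ∀ k, r < k → p.coeff k = 0) (n : ℕ) (f : ℝ⟦X⟧) :
    corr n (p * f) (p * f) = ∑ i : Fin r, ∑ j : Fin r, p.coeff (i + 1) * p.coeff (j + 1) *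
      corr n (PowerSeries.X ^ ((i : ℕ) + 1) * f) (PowerSeries.X ^ ((j : ℕ) + 1) * f) := by
  rw [coe_eq_sum h0 hr, Finset.sum_mul, corr_sum_right]
  conv_lhs => enter [2, i]; rw [corr_comm, corr_sum_right]
  refine Finset.sum_congr rfl fun i _ => Finset.sum_congr rfl fun j _ => ?_
  rw [mul_assoc, mul_assoc, corr_smul_right, corr_comm, corr_smul_right,
    corr_comm n (PowerSeries.X ^ ((i : ℕ) + 1) * f)]
  ring

variable {ι : Type*}

/-- The factor `⊤` encodes uniformity: one threshold in `n` serves all indices. -/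
theorem eventually_forall_of_prod_top {P : ℕ × ι → Prop}
    (h : ∀ᶠ p in atTop ×ˢ ⊤, P p) : ∀ᶠ n in atTop, ∀ i, P (n, i) := by
  rw [← principal_univ, eventually_prod_principal_iff] at h
  exact h.mono fun n hn i => hn i (Set.mem_univ i)

/-- The regressors of a family of ARX systems are uniformly excited, if the parameters `z i = (θ, l)`
stay in a compact set on which either the input or the noise is exciting in the direction `l`. -/
theorem exists_le_corr_linReg {K : Set (Param na nb × Param na nb)} (hK : IsCompact K)
    {z : ι → Param na nb × Param na nb} (hz : ∀ i, z i ∈ K)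
    {u : ℝ⟦X⟧} {ρ : ℕ → ℝ}
    (hρ : ∀ i j : ℕ, Tendsto (fun n => corr n (PowerSeries.X ^ i * u) (PowerSeries.X ^ j * u))
        atTop (𝓝 (ρ ((i : ℤ) - (j : ℤ)).natAbs)))
    (hpos : ∀ x : Fin (na + nb) → ℝ, x ≠ 0 →
        0 < ∑ i, ∑ j, x i * x j * ρ ((i : ℤ) - (j : ℤ)).natAbs)
    {y e : ι → ℝ⟦X⟧} (hsys : ∀ i, (polyA (z i).1 : ℝ⟦X⟧) * y i = (polyB (z i).1 : ℝ⟦X⟧) * u + e i)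
    (hu : BddPow fun _ : ι => u) (he : BddPow e)
    (hue : ∀ k l, Uncorr (fun _ : ι => PowerSeries.X ^ k * u) fun i => PowerSeries.X ^ l * e i)
    {γ : ℝ} (hγ : 0 ≤ γ)
    (hnoise : ∀ δ > 0, ∀ᶠ p : ℕ × ι in atTop ×ˢ ⊤,
      γ * ∑ k, (z p.2).2 (Sum.inl k) ^ 2 - δ ≤
        corr p.1 (((polyA (z p.2).2 - 1 : ℝ[X]) : ℝ⟦X⟧) * e p.2)
          (((polyA (z p.2).2 - 1 : ℝ[X]) : ℝ⟦X⟧) * e p.2))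
    (hKpos : ∀ x ∈ K, crossPoly x.1 x.2 = 0 → 0 < γ * ∑ k, x.2 (Sum.inl k) ^ 2) :
    ∃ c > 0, ∀ᶠ n in atTop, ∀ i,
      c ≤ corr n (linReg (z i).2 (y i) u) (linReg (z i).2 (y i) u) := by
  set f : Param na nb × Param na nb → ℝ := fun x =>
    ∑ i : Fin (na + nb), ∑ j : Fin (na + nb), (crossPoly x.1 x.2).coeff (i + 1) *
      (crossPoly x.1 x.2).coeff (j + 1) * ρ ((i : ℤ) - (j : ℤ)).natAbs with hf
  set g : Param na nb × Param na nb → ℝ := fun x => γ * ∑ k, x.2 (Sum.inl k) ^ 2 with hg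
  have hcont : Continuous fun x => f x + g x := by
    refine Continuous.add ?_ (by fun_prop)
    refine continuous_finsetSum _ fun i _ => continuous_finsetSum _ fun j _ => ?_
    exact ((continuous_coeff_crossPoly _).mul (continuous_coeff_crossPoly _)).mul continuous_const
  have hg0 : ∀ x, 0 ≤ g x := fun x => by positivity
  -- The input term `f` is positive unless `crossPoly` vanishes; then only the noise term `g` is
  -- left, and `hKpos` takes over. Compactness turns positivity into a uniform bound `a`.
  have hfg : ∀ x ∈ K, 0 < f x + g x := by
    intro x hx
    by_cases h0 : (fun i : Fin (na + nb) => (crossPoly x.1 x.2).coeff (i + 1)) = 0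
    · have hD : crossPoly x.1 x.2 = 0 := by
        ext k
        rw [Polynomial.coeff_zero]
        rcases k with _ | k
        · exact coeff_crossPoly_zero _ _
        by_cases hk : k < na + nb
        · exact congrFun h0 ⟨k, hk⟩
        · exact coeff_crossPoly_eq_zero _ _ (by omega)
      have hf0 : f x = 0 := by simp [hf, hD]
      rw [hf0, zero_add]
      exact hKpos x hx hD
    · exact add_pos_of_pos_of_nonneg (hpos _ h0) (hg0 x)
  obtain ⟨a, ha, haK⟩ := hK.exists_forall_le' hcont.continuousOn hfg
  have hDomA : Dom fun i => (polyA (z i).1 : ℝ⟦X⟧) :=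
    Dom.of_isCompact hK (p := fun x => polyA x.1)
      (fun k => (continuous_coeff_polyA k).comp continuous_fst) na
      (fun x => natDegree_polyA_le _) hz
  have hDomP : Dom fun i => ((polyA (z i).2 - 1 : ℝ[X]) : ℝ⟦X⟧) :=
    Dom.of_isCompact hK (p := fun x => polyA x.2 - 1)
      (fun k => (continuous_coeff_polyA_sub_one k).comp continuous_snd) na
      (fun x => natDegree_polyA_sub_one_le _) hz
  have hDomD : Dom fun i => (crossPoly (z i).1 (z i).2 : ℝ⟦X⟧) :=
    Dom.of_isCompact hK (p := fun x => crossPoly x.1 x.2) continuous_coeff_crossPoly (na + nb)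
      (fun x => by
        rw [Polynomial.natDegree_le_iff_coeff_eq_zero]
        exact fun k hk => coeff_crossPoly_eq_zero _ _ hk) hz
  have hcross : Uncorr (fun i => (crossPoly (z i).1 (z i).2 : ℝ⟦X⟧) * u)
      fun i => ((polyA (z i).2 - 1 : ℝ[X]) : ℝ⟦X⟧) * e i := by
    refine Uncorr.mul_right hDomP (hu.mul hDomD) he fun l _ => Uncorr.symm ?_
    exact Uncorr.mul_right hDomD (he.X_pow_mul l) hu fun k _ => (hue k l).symm
  have hinput : Tendsto (fun p : ℕ × ι =>
      corr p.1 ((crossPoly (z p.2).1 (z p.2).2 : ℝ⟦X⟧) * u)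
        ((crossPoly (z p.2).1 (z p.2).2 : ℝ⟦X⟧) * u) - f (z p.2)) (atTop ×ˢ ⊤) (𝓝 0) := by
    obtain ⟨b, -, hb⟩ := hDomD
    have h1 : ∀ p : ℕ × ι, corr p.1 ((crossPoly (z p.2).1 (z p.2).2 : ℝ⟦X⟧) * u)
        ((crossPoly (z p.2).1 (z p.2).2 : ℝ⟦X⟧) * u) - f (z p.2)
        = ∑ i : Fin (na + nb), ∑ j : Fin (na + nb),
          (crossPoly (z p.2).1 (z p.2).2).coeff (i + 1) *
          (crossPoly (z p.2).1 (z p.2).2).coeff (j + 1) *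
          (corr p.1 (PowerSeries.X ^ ((i : ℕ) + 1) * u) (PowerSeries.X ^ ((j : ℕ) + 1) * u)
            - ρ ((i : ℤ) - (j : ℤ)).natAbs) := by
      intro p
      rw [corr_polynomial_mul (coeff_crossPoly_zero _ _)
        (fun k hk => coeff_crossPoly_eq_zero _ _ hk), hf]
      simp only [← Finset.sum_sub_distrib, ← mul_sub]
    simp only [h1]
    rw [show (0 : ℝ) = ∑ i : Fin (na + nb), ∑ j : Fin (na + nb), (0 : ℝ) by simp]
    refine tendsto_finsetSum _ fun i _ => tendsto_finsetSum _ fun j _ => ?_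
    refine bdd_le_mul_tendsto_zero' (b (i + 1) * b (j + 1)) (Eventually.of_forall fun p => ?_) ?_
    · rw [abs_mul]
      have hi := hb p.2 (i + 1)
      have hj := hb p.2 (j + 1)
      rw [Polynomial.coeff_coe] at hi hj
      exact mul_le_mul hi hj (abs_nonneg _) ((abs_nonneg _).trans hi)
    · have h2 := (hρ (i + 1) (j + 1)).sub_const (ρ ((i : ℤ) - (j : ℤ)).natAbs)
      rw [show (((i : ℕ) + 1 : ℕ) : ℤ) - (((j : ℕ) + 1 : ℕ) : ℤ) = (i : ℤ) - (j : ℤ) by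
        push_cast; ring, sub_self] at h2
      exact h2.comp tendsto_fst
  -- Out of `f + g ≥ a`, the input power, the noise power and twice the cross term each lose at most
  -- `a / 4`.
  have hlow : ∀ᶠ p : ℕ × ι in atTop ×ˢ ⊤, a / 4 ≤
      corr p.1 ((polyA (z p.2).1 : ℝ⟦X⟧) * linReg (z p.2).2 (y p.2) u)
        ((polyA (z p.2).1 : ℝ⟦X⟧) * linReg (z p.2).2 (y p.2) u) := by
    have hc := hcross.const_mul 2
    rw [mul_zero] at hc
    filter_upwards [hinput.eventually (lt_mem_nhds (show -(a / 4) < 0 by linarith)),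
      hc.eventually (gt_mem_nhds (show 0 < a / 4 by linarith)), hnoise (a / 4) (by linarith)]
      with p h1 h2 h3
    rw [polyA_mul_linReg (hsys p.2), corr_sub_left, corr_sub_right, corr_sub_right,
      corr_comm _ (_ * e p.2) (_ * u)]
    have h4 := haK _ (hz p.2)
    simp only [hg] at h4
    linarith
  obtain ⟨b, hb, hb'⟩ := hDomA
  -- The filter `A(θ)` has gain at most `∑' k, b k`; the `+ 1` only keeps the denominator positive.
  refine ⟨a / 4 / ((∑' k, b k) ^ 2 + 1), by positivity, ?_⟩
  filter_upwards [eventually_forall_of_prod_top hlow] with n hn i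
  rw [div_le_iff₀ (by positivity)]
  refine (hn i).trans ((corr_mul_self_le n _ _).trans ?_)
  have h6 : ∑ k ∈ Finset.range (n + 1), |coeff k (polyA (z i).1 : ℝ⟦X⟧)| ≤ ∑' k, b k :=
    (Finset.sum_le_sum fun k _ => hb' i k).trans
      (hb.sum_le_tsum _ fun k _ => (abs_nonneg _).trans (hb' i k))
  rw [mul_comm]
  have h7 := corr_self_nonneg n (linReg (z i).2 (y i) u)
  gcongr
  have h8 : (∑ k ∈ Finset.range (n + 1), |coeff k (polyA (z i).1 : ℝ⟦X⟧)|) ^ 2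
      ≤ (∑' k, b k) ^ 2 := by gcongr
  linarith

end SPS

namespace SPS

variable {na nb : ℕ}

/-! ### Normalisation by the inverse square root of the sample covariance -/

theorem isHermitian_sampleCov (φ : ℕ → Fin na ⊕ Fin nb → ℝ) (n : ℕ) :
    (sampleCov φ n).IsHermitian := by
  rw [Matrix.IsHermitian, Matrix.conjTranspose_eq_transpose_of_trivial]
  ext i j
  simp [sampleCov, Matrix.sum_apply, Matrix.vecMulVec_apply, mul_comm]

section

variable {R : Matrix (Fin na ⊕ Fin nb) (Fin na ⊕ Fin nb) ℝ}

theorem continuousOn_spectrum (f : ℝ → ℝ) : ContinuousOn f (spectrum ℝ R) :=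
  Matrix.finite_real_spectrum.continuousOn f

theorem isHermitian_invSqrt : (invSqrt R).IsHermitian :=
  cfc_predicate (R := ℝ) (p := IsSelfAdjoint) (fun x : ℝ => (√x)⁻¹) R

theorem mul_invSqrt_mul_invSqrt (hR : R.PosDef) : R * (invSqrt R * invSqrt R) = 1 := by
  have hsa : IsSelfAdjoint R := hR.isHermitian
  have hpos : ∀ x ∈ spectrum ℝ R, 0 < x := by
    intro x hx
    rw [hR.isHermitian.spectrum_real_eq_range_eigenvalues] at hx
    obtain ⟨i, rfl⟩ := hx
    exact hR.eigenvalues_pos i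
  have h1 : cfc (fun x : ℝ => x * ((√x)⁻¹ * (√x)⁻¹)) R = 1 := by
    rw [← cfc_one ℝ R]
    refine cfc_congr fun x hx => ?_
    have hx := hpos x hx
    have := Real.sq_sqrt hx.le
    have h2 := Real.sqrt_pos.2 hx
    simp only [Pi.one_apply]
    field_simp
    linarith
  rw [cfc_mul _ _ R (continuousOn_spectrum _) (continuousOn_spectrum _),
    cfc_mul _ _ R (continuousOn_spectrum _) (continuousOn_spectrum _), cfc_id' ℝ R] at h1
  exact h1

theorem norm_sq_toLp (x : Fin na ⊕ Fin nb → ℝ) : ‖(WithLp.toLp 2 x : Param na nb)‖ ^ 2 = x ⬝ᵥ x := by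
  rw [EuclideanSpace.real_norm_sq_eq]
  simp [dotProduct, pow_two]

theorem dotProduct_mulVec_comm (hR : R.IsHermitian) (x y : Fin na ⊕ Fin nb → ℝ) :
    x ⬝ᵥ (R *ᵥ y) = y ⬝ᵥ (R *ᵥ x) := by
  have hT : Rᵀ = R := by rwa [Matrix.IsHermitian, Matrix.conjTranspose_eq_transpose_of_trivial] at hR
  rw [Matrix.dotProduct_mulVec, ← Matrix.mulVec_transpose, hT, dotProduct_comm]

theorem posDef_of_forall_le (hR : R.IsHermitian) {c : ℝ} (hc : 0 < c)
    (h : ∀ x : Fin na ⊕ Fin nb → ℝ, c * (x ⬝ᵥ x) ≤ x ⬝ᵥ (R *ᵥ x)) : R.PosDef := by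
  refine Matrix.PosDef.of_dotProduct_mulVec_pos hR fun x hx => ?_
  rw [star_trivial]
  refine lt_of_lt_of_le (mul_pos hc ?_) (h x)
  rw [← norm_sq_toLp]
  have : (WithLp.toLp 2 x : Param na nb) ≠ 0 := by simpa using hx
  positivity

theorem exists_mulVec_eq_of_posDef (hR : R.PosDef) (v : Fin na ⊕ Fin nb → ℝ) :
    ∃ w, R *ᵥ w = v ∧ ‖(WithLp.toLp 2 (invSqrt R *ᵥ v) : Param na nb)‖ ^ 2 = v ⬝ᵥ w := by
  refine ⟨invSqrt R *ᵥ (invSqrt R *ᵥ v), ?_, ?_⟩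
  · rw [Matrix.mulVec_mulVec, Matrix.mulVec_mulVec, mul_assoc, mul_invSqrt_mul_invSqrt hR, Matrix.one_mulVec]
  · rw [norm_sq_toLp, dotProduct_mulVec_comm isHermitian_invSqrt]

/-- With `w = R⁻¹ v` the squared norm is `v·w`, and coercivity at `w` reads `c w·w ≤ v·w`. Expanding
`‖v - c w‖² ≥ 0` gives the claim. -/
theorem norm_sq_invSqrt_mulVec_le (hR : R.IsHermitian) {c : ℝ} (hc : 0 < c)
    (h : ∀ x : Fin na ⊕ Fin nb → ℝ, c * (x ⬝ᵥ x) ≤ x ⬝ᵥ (R *ᵥ x)) (v : Fin na ⊕ Fin nb → ℝ) :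
    c * ‖(WithLp.toLp 2 (invSqrt R *ᵥ v) : Param na nb)‖ ^ 2 ≤ v ⬝ᵥ v := by
  obtain ⟨w, hw, hv⟩ := exists_mulVec_eq_of_posDef (posDef_of_forall_le hR hc h) v
  rw [hv]
  have h1 := h w
  rw [hw, dotProduct_comm w v] at h1
  have h2 : 0 ≤ (v - c • w) ⬝ᵥ (v - c • w) := by
    rw [← norm_sq_toLp]; positivity
  simp only [sub_dotProduct, dotProduct_sub, smul_dotProduct, dotProduct_smul, smul_eq_mul,
    dotProduct_comm w v] at h2
  have h3 := mul_le_mul_of_nonneg_left h1 hc.le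
  linarith

/-- The number `v·R⁻¹v` is the maximum over `x` of `2 v·x - x·Rx`: expand `(w - x)·R(w - x) ≥ 0` at
`w = R⁻¹ v`. Any test vector thus bounds a normalised sum from below. -/
theorem le_norm_sq_invSqrt_mulVec (hR : R.PosDef) (v x : Fin na ⊕ Fin nb → ℝ) :
    2 * (v ⬝ᵥ x) - x ⬝ᵥ (R *ᵥ x) ≤ ‖(WithLp.toLp 2 (invSqrt R *ᵥ v) : Param na nb)‖ ^ 2 := by
  obtain ⟨w, hw, hv⟩ := exists_mulVec_eq_of_posDef hR v
  rw [hv]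
  have h2 := hR.posSemidef.dotProduct_mulVec_nonneg (w - x)
  rw [star_trivial, Matrix.mulVec_sub] at h2
  simp only [sub_dotProduct, dotProduct_sub, dotProduct_mulVec_comm hR.isHermitian w x, hw] at h2
  rw [dotProduct_comm w v, dotProduct_comm x v] at h2
  linarith

theorem forall_le_of_forall_unit {c : ℝ}
    (h : ∀ l : Param na nb, ‖l‖ = 1 → c ≤ (l : _ → ℝ) ⬝ᵥ (R *ᵥ (l : _ → ℝ)))
    (x : Fin na ⊕ Fin nb → ℝ) : c * (x ⬝ᵥ x) ≤ x ⬝ᵥ (R *ᵥ x) := by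
  rcases eq_or_ne x 0 with rfl | hx
  · simp
  set l : Param na nb := WithLp.toLp 2 x with hl
  have hl0 : l ≠ 0 := by simpa [hl] using hx
  have hn : 0 < ‖l‖ := norm_pos_iff.2 hl0
  have h1 := h (‖l‖⁻¹ • l) (by rw [norm_smul, norm_inv, norm_norm, inv_mul_cancel₀ hn.ne'])
  simp only [WithLp.ofLp_smul, Matrix.mulVec_smul, dotProduct_smul, smul_dotProduct, smul_eq_mul]
    at h1
  rw [← norm_sq_toLp]
  have h2 : c * ‖l‖ ^ 2 ≤ ‖l‖⁻¹ * (‖l‖⁻¹ * (l.ofLp ⬝ᵥ (R *ᵥ l.ofLp))) * ‖l‖ ^ 2 := by gcongr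
  refine h2.trans_eq ?_
  field_simp
  rfl

end

end SPS

namespace SPS

open scoped PowerSeries
open PowerSeries (coeff)

variable {na nb : ℕ} {ι : Type*}

/-! ### The reference sum and the sign-perturbed sums along a regular path -/

/-- The pathwise properties of the input and of the noise which the analysis of the reference sum
requires. -/
structure NoiseRegular (u e : ℕ → ℝ) : Prop where
  bdd : ∃ C : ℝ, ∀ n, corr n (sig e) (sig e) ≤ C
  lag : ∀ k, 1 ≤ k → Tendsto (fun n => corr n (sig e) (PowerSeries.X ^ k * sig e)) atTop (𝓝 0)
  cross : ∀ k l, Tendsto (fun n => corr n (PowerSeries.X ^ k * sig u) (PowerSeries.X ^ l * sig e))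
    atTop (𝓝 0)

/-- The pathwise properties of a sequence of signs which the analysis of the sign-perturbed sums
requires. -/
structure SignsRegular (u e s : ℕ → ℝ) : Prop where
  sign : ∀ t, 1 ≤ t → s t = 1 ∨ s t = -1
  lag : ∀ l, 1 ≤ l → ∀ x ∈ ({e, u} : Set (ℕ → ℝ)), ∀ y ∈ ({e, u} : Set (ℕ → ℝ)), ∀ j k,
    Tendsto (fun n => corr n (PowerSeries.X ^ j * sig x)
      (had (had (sig s) (PowerSeries.X ^ l * sig s)) (PowerSeries.X ^ k * sig y))) atTop (𝓝 0)
  cross : ∀ x ∈ ({e, u} : Set (ℕ → ℝ)), ∀ j k l,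
    Tendsto (fun n => corr n (PowerSeries.X ^ j * sig u)
      (had (PowerSeries.X ^ l * sig s) (PowerSeries.X ^ k * sig x))) atTop (𝓝 0)

theorem eq_inv_mul_of_polyA_mul_eq {θ : Param na nb} {y w : ℝ⟦X⟧}
    (h : (polyA θ : ℝ⟦X⟧) * y = w) : y = (polyA θ : ℝ⟦X⟧)⁻¹ * w := by
  rw [← h, ← mul_assoc, PowerSeries.inv_mul_cancel _ (constantCoeff_polyA θ), one_mul]

/-- Strict causality of the regressor: after solving for `y`, the filter acting on `e` is `-(A(l) -
1) / A(θ)`, whose constant term is zero. Hence lag `0` of `e` against itself, the only one with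
non-negligible correlation, never occurs. -/
theorem uncorr_linReg {θ l : ι → Param na nb} {u : ℝ⟦X⟧} {y e : ι → ℝ⟦X⟧}
    (hsys : ∀ i, (polyA (θ i) : ℝ⟦X⟧) * y i = (polyB (θ i) : ℝ⟦X⟧) * u + e i)
    (hA : Dom fun i => ((polyA (l i) - 1 : ℝ[X]) : ℝ⟦X⟧)) (hB : Dom fun i => (polyB (l i) : ℝ⟦X⟧))
    (hH : Dom fun i => (polyA (θ i) : ℝ⟦X⟧)⁻¹)
    (hG : Dom fun i => (polyB (θ i) : ℝ⟦X⟧) * (polyA (θ i) : ℝ⟦X⟧)⁻¹)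
    (hu : BddPow fun _ : ι => u) (he : BddPow e)
    (hee : ∀ k, 1 ≤ k → Uncorr e fun i => PowerSeries.X ^ k * e i)
    (heu : ∀ k, Uncorr e fun _ => PowerSeries.X ^ k * u) :
    Uncorr e fun i => linReg (l i) (y i) u := by
  have h : ∀ i, linReg (l i) (y i) u = ((polyB (l i) : ℝ⟦X⟧) - ((polyA (l i) - 1 : ℝ[X]) : ℝ⟦X⟧) *
      ((polyB (θ i) : ℝ⟦X⟧) * (polyA (θ i) : ℝ⟦X⟧)⁻¹)) * u
      - (((polyA (l i) - 1 : ℝ[X]) : ℝ⟦X⟧) * (polyA (θ i) : ℝ⟦X⟧)⁻¹) * e i := by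
    intro i
    rw [linReg, eq_inv_mul_of_polyA_mul_eq (hsys i)]
    ring
  simp only [h]
  refine (Uncorr.mul_right (hB.sub (hA.mul hG)) he hu fun k _ => heu k).sub_right
    (Uncorr.mul_right (hA.mul hH) he he fun k hk => hee k ?_)
  rcases Nat.eq_zero_or_pos k with rfl | hk0
  · obtain ⟨i, hi⟩ := hk
    refine (hi ?_).elim
    rw [PowerSeries.coeff_mul]
    simp [coeff_polyA_zero]
  · exact hk0

theorem corr_had_right (n : ℕ) (a f g : ℝ⟦X⟧) : corr n f (had a g) = corr n (had a f) g :=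
  (corr_had n a f g).symm

/-- Multiplication by `β` does not commute with filtering but is self-adjoint for `corr`: move it
onto `f`, filter the other factor, move it back. The bound `|β| ≤ 1` keeps the power of `β f` under
control. -/
theorem uncorr_had_filtered {β : ℝ⟦X⟧} (hβ : ∀ k, |coeff k β| ≤ 1) {f K L : ι → ℝ⟦X⟧}
    (hf : BddPow f) (hK : Dom K) (hL : Dom L) {e u : ℝ⟦X⟧} (he : BddPow fun _ : ι => e)
    (hu : BddPow fun _ : ι => u)
    (hfe : ∀ k, Uncorr f fun _ => had β (PowerSeries.X ^ k * e))
    (hfu : ∀ k, Uncorr f fun _ => had β (PowerSeries.X ^ k * u)) :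
    Uncorr f fun i => had β (K i * e + L i * u) := by
  have hb : BddPow fun i => had β (f i) := hf.had fun _ => hβ
  have h1 : Uncorr (fun i => had β (f i)) fun i => K i * e :=
    Uncorr.mul_right hK hb he fun k _ => by simpa only [Uncorr, corr_had] using hfe k
  have h2 : Uncorr (fun i => had β (f i)) fun i => L i * u :=
    Uncorr.mul_right hL hb hu fun k _ => by simpa only [Uncorr, corr_had] using hfu k
  simpa only [Uncorr, corr_had] using h1.add_right h2

theorem abs_coeff_sig_le_one {s : ℕ → ℝ} (hs : ∀ t, 1 ≤ t → s t = 1 ∨ s t = -1) (t : ℕ) :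
    |coeff t (sig s)| ≤ 1 := by
  rcases Nat.eq_zero_or_pos t with rfl | ht
  · simp [coeff_sig_zero]
  · rw [coeff_sig _ ht.ne']
    rcases hs t ht with h | h <;> simp [h]

theorem abs_coeff_X_pow_mul_le_one {f : ℝ⟦X⟧} (hf : ∀ t, |coeff t f| ≤ 1) (k t : ℕ) :
    |coeff t (PowerSeries.X ^ k * f)| ≤ 1 := by
  rw [PowerSeries.coeff_X_pow_mul']
  split_ifs
  · exact hf _
  · simp

theorem abs_coeff_had_le_one {f g : ℝ⟦X⟧} (hf : ∀ t, |coeff t f| ≤ 1) (hg : ∀ t, |coeff t g| ≤ 1)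
    (t : ℕ) : |coeff t (had f g)| ≤ 1 := by
  rw [coeff_had, abs_mul]
  exact mul_le_one₀ (hf t) (abs_nonneg _) (hg t)

/-! ### Correlations of sign-perturbed signals -/

section SignedSums

variable {u e s : ℕ → ℝ} {K L : ι → ℝ⟦X⟧}

theorem bddPow_filtered (hK : Dom K) (hL : Dom L)
    (hu : BddPow fun _ : ι => sig u) (he : BddPow fun _ : ι => sig e) :
    BddPow fun i => K i * sig e + L i * sig u := (he.mul hK).add (hu.mul hL)

/-- Sign-perturbed signals are uncorrelated with the input, at all lags. -/
theorem SignsRegular.uncorr_input (hs : SignsRegular u e s) (hK : Dom K) (hL : Dom L)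
    (hu : BddPow fun _ : ι => sig u) (he : BddPow fun _ : ι => sig e) (k l : ℕ) :
    Uncorr (fun _ => PowerSeries.X ^ k * sig u)
      fun i => PowerSeries.X ^ l * had (sig s) (K i * sig e + L i * sig u) := by
  have h : ∀ i, PowerSeries.X ^ l * had (sig s) (K i * sig e + L i * sig u)
      = had (PowerSeries.X ^ l * sig s)
        ((PowerSeries.X ^ l * K i) * sig e + (PowerSeries.X ^ l * L i) * sig u) := by
    intro i; rw [X_pow_mul_had]; congr 1; ring
  simp only [h]
  refine uncorr_had_filtered (abs_coeff_X_pow_mul_le_one (abs_coeff_sig_le_one hs.sign) l)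
    (hu.X_pow_mul k) ((Dom.X_pow l).mul hK) ((Dom.X_pow l).mul hL) he hu (fun j => ?_) fun j => ?_
  · exact uncorr_const (hs.cross e (by simp) k j l)
  · exact uncorr_const (hs.cross u (by simp) k j l)

/-- Sign-perturbed signals are uncorrelated with themselves, at all positive lags. -/
theorem SignsRegular.uncorr_self (hs : SignsRegular u e s) (hK : Dom K) (hL : Dom L)
    (hu : BddPow fun _ : ι => sig u) (he : BddPow fun _ : ι => sig e) {l : ℕ} (hl : 1 ≤ l) :
    Uncorr (fun i => had (sig s) (K i * sig e + L i * sig u))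
      fun i => PowerSeries.X ^ l * had (sig s) (K i * sig e + L i * sig u) := by
  have hs1 := abs_coeff_sig_le_one hs.sign
  set β := had (sig s) (PowerSeries.X ^ l * sig s) with hβdef
  have hβ : ∀ t, |coeff t β| ≤ 1 := abs_coeff_had_le_one hs1 (abs_coeff_X_pow_mul_le_one hs1 l)
  have h : ∀ n i, corr n (had (sig s) (K i * sig e + L i * sig u))
      (PowerSeries.X ^ l * had (sig s) (K i * sig e + L i * sig u))
      = corr n (K i * sig e + L i * sig u)
        (had β ((PowerSeries.X ^ l * K i) * sig e + (PowerSeries.X ^ l * L i) * sig u)) := by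
    intro n i
    rw [X_pow_mul_had, corr_had, hβdef, had_assoc]
    congr 3; ring
  simp only [Uncorr, h]
  have hN := bddPow_filtered hK hL hu he
  -- Both factors are filtered signals, so they are expanded in turn: here the left one, against a
  -- plain delayed signal, and in the last line the right one.
  have step : ∀ y ∈ ({e, u} : Set (ℕ → ℝ)), ∀ k, BddPow (fun _ : ι => sig y) →
      Uncorr (fun i => K i * sig e + L i * sig u)
        fun _ => had β (PowerSeries.X ^ k * sig y) := by
    intro y hy k hby
    have h1 : Uncorr (fun _ : ι => PowerSeries.X ^ k * sig y)
        fun i => had β (K i * sig e + L i * sig u) := by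
      refine uncorr_had_filtered hβ (hby.X_pow_mul k) hK hL he hu (fun j => ?_) fun j => ?_
      · exact uncorr_const (hs.lag l hl y hy e (by simp) k j)
      · exact uncorr_const (hs.lag l hl y hy u (by simp) k j)
    have h2 := h1.symm
    simpa only [Uncorr, corr_had] using h2
  exact uncorr_had_filtered hβ hN ((Dom.X_pow l).mul hK) ((Dom.X_pow l).mul hL) he hu
    (fun k => step e (by simp) k he) (fun k => step u (by simp) k hu)

theorem SignsRegular.corr_had_self (hs : SignsRegular u e s) (n : ℕ) {f : ℝ⟦X⟧}
    (hf : coeff 0 f = 0) : corr n (had (sig s) f) (had (sig s) f) = corr n f f := by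
  rw [corr, corr]
  congr 1
  refine Finset.sum_congr rfl fun t _ => ?_
  rcases Nat.eq_zero_or_pos t with rfl | ht
  · simp [coeff_had, hf]
  · rw [coeff_had, coeff_sig _ ht.ne']
    rcases hs.sign t ht with h | h <;> simp [h]

end SignedSums

/-- The power of a filtered white signal is bounded from below. -/
theorem eventually_le_corr_polynomial_mul {d : ℕ} {p : ι → ℝ[X]} (h0 : ∀ i, (p i).coeff 0 = 0)
    (hd : ∀ i k, d < k → (p i).coeff k = 0) (hp : Dom fun i => (p i : ℝ⟦X⟧)) {e : ι → ℝ⟦X⟧}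
    (hee : ∀ k, 1 ≤ k → Uncorr e fun i => PowerSeries.X ^ k * e i) {γ : ℝ}
    (hγ : ∀ᶠ q : ℕ × ι in atTop ×ˢ ⊤, 2 * γ ≤ corr q.1 (e q.2) (e q.2)) {δ : ℝ} (hδ : 0 < δ) :
    ∀ᶠ q : ℕ × ι in atTop ×ˢ ⊤, γ * ∑ k : Fin d, (p q.2).coeff (k + 1) ^ 2 - δ ≤
      corr q.1 (p q.2 * e q.2) (p q.2 * e q.2) := by
  obtain ⟨b, -, hb⟩ := hp
  have hoff : ∀ i j : ℕ, i ≠ j →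
      Uncorr (fun x => PowerSeries.X ^ i * e x) fun x => PowerSeries.X ^ j * e x := by
    have hlt : ∀ i k : ℕ, 1 ≤ k →
        Uncorr (fun x => PowerSeries.X ^ i * e x) fun x => PowerSeries.X ^ (i + k) * e x := by
      intro i k hk
      simpa only [pow_add, mul_assoc] using (hee k hk).X_pow_mul i
    intro i j hij
    rcases lt_or_gt_of_ne hij with h | h
    · obtain ⟨k, rfl⟩ := Nat.exists_eq_add_of_lt h
      exact hlt i (k + 1) (by omega)
    · obtain ⟨k, rfl⟩ := Nat.exists_eq_add_of_lt h
      exact (hlt j (k + 1) (by omega)).symm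
  -- The power of the delayed signal at `n` is `(n - k) / n` times the undelayed power at `n - k`.
  -- The ratio is at least `1/2` once `n > 2k`, whence the factor `2` in the hypothesis.
  have hdiag : ∀ k : ℕ, ∀ᶠ q : ℕ × ι in atTop ×ˢ ⊤,
      γ ≤ corr q.1 (PowerSeries.X ^ k * e q.2) (PowerSeries.X ^ k * e q.2) := by
    intro k
    have hs : Tendsto (fun q : ℕ × ι => (q.1 - k, q.2)) (atTop ×ˢ ⊤) (atTop ×ˢ ⊤) :=
      (tendsto_sub_atTop_nat k).prodMap tendsto_id
    have h2 : ∀ᶠ q : ℕ × ι in atTop ×ˢ ⊤, 2 * k < q.1 :=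
      tendsto_fst.eventually (eventually_gt_atTop (2 * k))
    filter_upwards [hs.eventually hγ, h2] with q hq hk
    obtain ⟨m, hm⟩ := Nat.exists_eq_add_of_lt hk
    rw [show q.1 = (k + m + 1) + k by omega, corr_X_pow_mul (by omega)]
    simp only [show q.1 - k = k + m + 1 by omega] at hq
    have hc := corr_self_nonneg (k + m + 1) (e q.2)
    have hr : (1 / 2 : ℝ) ≤ ((k + m + 1 : ℕ) : ℝ) / ((k + m + 1 + k : ℕ) : ℝ) := by
      rw [div_le_div_iff₀ (by norm_num) (by positivity)]
      push_cast
      linarith [(Nat.cast_nonneg m : (0 : ℝ) ≤ m)]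
    nlinarith [mul_le_mul_of_nonneg_right hr hc]
  have hsum : Tendsto (fun q : ℕ × ι => ∑ i : Fin d, ∑ j : Fin d,
      (p q.2).coeff (i + 1) * (p q.2).coeff (j + 1) *
        (if i = j then 0 else corr q.1 (PowerSeries.X ^ ((i : ℕ) + 1) * e q.2)
          (PowerSeries.X ^ ((j : ℕ) + 1) * e q.2))) (atTop ×ˢ ⊤) (𝓝 0) := by
    rw [show (0 : ℝ) = ∑ i : Fin d, ∑ j : Fin d, (0 : ℝ) by simp]
    refine tendsto_finsetSum _ fun i _ => tendsto_finsetSum _ fun j _ => ?_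
    refine bdd_le_mul_tendsto_zero' (b (i + 1) * b (j + 1)) (Eventually.of_forall fun q => ?_) ?_
    · rw [abs_mul]
      have hi := hb q.2 (i + 1)
      have hj := hb q.2 (j + 1)
      rw [Polynomial.coeff_coe] at hi hj
      exact mul_le_mul hi hj (abs_nonneg _) ((abs_nonneg _).trans hi)
    · by_cases hij : i = j
      · simpa [hij] using tendsto_const_nhds
      · simp only [hij, if_false]
        exact hoff _ _ (by simpa [Fin.ext_iff] using hij)
  have hall : ∀ᶠ q : ℕ × ι in atTop ×ˢ ⊤, ∀ k : Fin d,
      γ ≤ corr q.1 (PowerSeries.X ^ ((k : ℕ) + 1) * e q.2)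
        (PowerSeries.X ^ ((k : ℕ) + 1) * e q.2) :=
    eventually_all.2 fun k => hdiag _
  filter_upwards [hsum.eventually (lt_mem_nhds (show -δ < 0 by linarith)), hall] with q h1 h2
  rw [corr_polynomial_mul (h0 q.2) (hd q.2)]
  have h3 : ∀ i : Fin d, ∑ j : Fin d, (p q.2).coeff (i + 1) * (p q.2).coeff (j + 1) *
      corr q.1 (PowerSeries.X ^ ((i : ℕ) + 1) * e q.2) (PowerSeries.X ^ ((j : ℕ) + 1) * e q.2)
      = (p q.2).coeff (i + 1) ^ 2 * corr q.1 (PowerSeries.X ^ ((i : ℕ) + 1) * e q.2)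
        (PowerSeries.X ^ ((i : ℕ) + 1) * e q.2)
      + ∑ j : Fin d, (p q.2).coeff (i + 1) * (p q.2).coeff (j + 1) *
        (if i = j then 0 else corr q.1 (PowerSeries.X ^ ((i : ℕ) + 1) * e q.2)
          (PowerSeries.X ^ ((j : ℕ) + 1) * e q.2)) := by
    intro i
    rw [← Finset.add_sum_erase _ _ (Finset.mem_univ i),
      ← Finset.add_sum_erase (a := i) Finset.univ (fun j => _ * ite _ _ _) (Finset.mem_univ i)]
    simp only [if_true, mul_zero, zero_add, pow_two]
    congr 1
    refine Finset.sum_congr rfl fun j hj => ?_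
    rw [if_neg (Finset.ne_of_mem_erase hj).symm]
  simp only [h3, Finset.sum_add_distrib]
  have h4 : γ * ∑ k : Fin d, (p q.2).coeff (k + 1) ^ 2 ≤ ∑ i : Fin d, (p q.2).coeff (i + 1) ^ 2 *
      corr q.1 (PowerSeries.X ^ ((i : ℕ) + 1) * e q.2)
        (PowerSeries.X ^ ((i : ℕ) + 1) * e q.2) := by
    rw [Finset.mul_sum]
    refine Finset.sum_le_sum fun k _ => ?_
    rw [mul_comm]
    exact mul_le_mul_of_nonneg_left (h2 k) (sq_nonneg _)
  linarith

end SPS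

namespace SPS

open scoped PowerSeries
open PowerSeries (coeff)

variable {na nb : ℕ} {ι : Type*}

/-! ### Dominated filters from stability and compactness; excitation by white noise -/

theorem UniformlyStable.dom_inv {Θc : Set (Param na nb)} (h : UniformlyStable Θc)
    {θ : ι → Param na nb} (hθ : ∀ i, θ i ∈ Θc) : Dom fun i => (polyA (θ i) : ℝ⟦X⟧)⁻¹ := by
  obtain ⟨⟨b, hb, hb'⟩, -⟩ := h
  exact ⟨b, hb, fun i k => hb' _ (hθ i) k⟩

theorem UniformlyStable.dom_mul_inv {Θc : Set (Param na nb)} (h : UniformlyStable Θc)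
    {θ : ι → Param na nb} (hθ : ∀ i, θ i ∈ Θc) :
    Dom fun i => (polyB (θ i) : ℝ⟦X⟧) * (polyA (θ i) : ℝ⟦X⟧)⁻¹ := by
  obtain ⟨-, b, hb, hb'⟩ := h
  exact ⟨b, hb, fun i k => hb' _ (hθ i) k⟩

theorem dom_polyA {K : Set (Param na nb)} (hK : IsCompact K) {l : ι → Param na nb}
    (hl : ∀ i, l i ∈ K) : Dom fun i => (polyA (l i) : ℝ⟦X⟧) :=
  Dom.of_isCompact hK continuous_coeff_polyA na natDegree_polyA_le hl

theorem dom_polyA_sub_one {K : Set (Param na nb)} (hK : IsCompact K) {l : ι → Param na nb}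
    (hl : ∀ i, l i ∈ K) : Dom fun i => ((polyA (l i) - 1 : ℝ[X]) : ℝ⟦X⟧) :=
  Dom.of_isCompact hK continuous_coeff_polyA_sub_one na natDegree_polyA_sub_one_le hl

theorem dom_polyB {K : Set (Param na nb)} (hK : IsCompact K) {l : ι → Param na nb}
    (hl : ∀ i, l i ∈ K) : Dom fun i => (polyB (l i) : ℝ⟦X⟧) :=
  Dom.of_isCompact hK continuous_coeff_polyB nb natDegree_polyB_le hl

theorem bddPow_of_tendsto {f : ℝ⟦X⟧} {c : ℝ} (h : Tendsto (fun n => corr n f f) atTop (𝓝 c)) :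
    BddPow fun _ : ι => f := by
  obtain ⟨C, hC⟩ := h.bddAbove_range
  exact ⟨C, fun n _ => hC ⟨n, rfl⟩⟩

theorem NoiseRegular.bddPow {u e : ℕ → ℝ} (h : NoiseRegular u e) :
    BddPow fun _ : ι => sig e := by
  obtain ⟨C, hC⟩ := h.bdd
  exact ⟨C, fun n _ => hC n⟩

theorem sig_predError_arxOutput (θstar θ : Param na nb) (u e : ℕ → ℝ) :
    sig (predError (arxOutput θstar u e) u θ)
      = sig e + linReg (θstar - θ) (sig (arxOutput θstar u e)) (sig u) := by
  rw [sig_predError, linReg, polyA_sub, polyB_sub, Polynomial.coe_sub, Polynomial.coe_sub]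
  linear_combination polyA_mul_sig_arxOutput θstar u e

/-- Exhibits the prediction errors as filters of the true noise and of the input, dominated
uniformly in `θ`; this is the form the sign-perturbation lemmas require. -/
theorem sig_predError_eq_filtered (θstar θ : Param na nb) (u e : ℕ → ℝ) :
    sig (predError (arxOutput θstar u e) u θ)
      = ((polyA θ : ℝ⟦X⟧) * (polyA θstar : ℝ⟦X⟧)⁻¹) * sig e
        + ((polyA θ : ℝ⟦X⟧) * ((polyB θstar : ℝ⟦X⟧) * (polyA θstar : ℝ⟦X⟧)⁻¹)
          - (polyB θ : ℝ⟦X⟧)) * sig u := by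
  rw [sig_predError, eq_inv_mul_of_polyA_mul_eq (polyA_mul_sig_arxOutput θstar u e)]
  ring

/-- The regressors of a compact family of ARX systems that are driven by white noise of
non-vanishing power, uncorrelated with the input, are uniformly exciting. -/
theorem exists_le_corr_linReg_of_white {T : Set (Param na nb)} (hT : IsCompact T)
    {u : ℝ⟦X⟧} {ρ : ℕ → ℝ}
    (hρ : ∀ i j : ℕ, Tendsto (fun n => corr n (PowerSeries.X ^ i * u) (PowerSeries.X ^ j * u))
        atTop (𝓝 (ρ ((i : ℤ) - (j : ℤ)).natAbs)))
    (hpos : ∀ x : Fin (na + nb) → ℝ, x ≠ 0 →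
        0 < ∑ i, ∑ j, x i * x j * ρ ((i : ℤ) - (j : ℤ)).natAbs)
    {y e : T → ℝ⟦X⟧} (hsys : ∀ θ : T, (polyA (θ : Param na nb) : ℝ⟦X⟧) * y θ
      = (polyB (θ : Param na nb) : ℝ⟦X⟧) * u + e θ)
    (he : BddPow e) (hee : ∀ k, 1 ≤ k → Uncorr e fun θ => PowerSeries.X ^ k * e θ)
    (hue : ∀ k l, Uncorr (fun _ : T => PowerSeries.X ^ k * u) fun θ => PowerSeries.X ^ l * e θ)
    {γ : ℝ} (hγ : 0 < γ)
    (hpow : ∀ᶠ q : ℕ × T in atTop ×ˢ ⊤, 2 * γ ≤ corr q.1 (e q.2) (e q.2)) :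
    ∃ c > 0, ∀ᶠ n in atTop, ∀ θ : T, ∀ l : Param na nb, ‖l‖ = 1 →
      c ≤ corr n (linReg l (y θ) u) (linReg l (y θ) u) := by
  have hub : BddPow fun _ : ↥(T ×ˢ Metric.sphere (0 : Param na nb) 1) => u := by
    have h0 := hρ 0 0
    simp only [pow_zero, one_mul] at h0
    exact bddPow_of_tendsto h0
  let r : ↥(T ×ˢ Metric.sphere (0 : Param na nb) 1) → T := fun i => ⟨i.1.1, i.2.1⟩
  have hee' : ∀ k, 1 ≤ k → Uncorr (fun i => e (r i)) fun i => PowerSeries.X ^ k * e (r i) :=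
    fun k hk => Uncorr.comp (hee k hk) r
  have hue' : ∀ k l, Uncorr (fun _ : ↥(T ×ˢ Metric.sphere (0 : Param na nb) 1) =>
      PowerSeries.X ^ k * u) fun i => PowerSeries.X ^ l * e (r i) :=
    fun k l => Uncorr.comp (hue k l) r
  have hnoise : ∀ δ > 0, ∀ᶠ q : ℕ × ↥(T ×ˢ Metric.sphere (0 : Param na nb) 1) in atTop ×ˢ ⊤,
      γ * ∑ k, q.2.1.2 (Sum.inl k) ^ 2 - δ ≤
        corr q.1 (((polyA q.2.1.2 - 1 : ℝ[X]) : ℝ⟦X⟧) * e (r q.2))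
          (((polyA q.2.1.2 - 1 : ℝ[X]) : ℝ⟦X⟧) * e (r q.2)) := by
    intro δ hδ
    have h1 := eventually_le_corr_polynomial_mul (d := na)
      (p := fun i : ↥(T ×ˢ Metric.sphere (0 : Param na nb) 1) => polyA i.1.2 - 1)
      (fun i => by simp [coeff_polyA_zero])
      (fun i k hk => Polynomial.coeff_eq_zero_of_natDegree_lt
        ((natDegree_polyA_sub_one_le _).trans_lt hk))
      (dom_polyA_sub_one (isCompact_sphere (0 : Param na nb) 1) fun i => i.2.2)
      (e := fun i => e (r i)) hee' ((tendsto_reindex r).eventually hpow) hδ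
    refine h1.mono fun q hq => ?_
    simpa [Polynomial.coeff_one, coeff_polyA_succ] using hq
  obtain ⟨c, hc, hexc⟩ := exists_le_corr_linReg (hT.prod (isCompact_sphere (0 : Param na nb) 1))
    (z := Subtype.val) (fun i => i.2) hρ hpos (y := fun i => y (r i)) (e := fun i => e (r i))
    (fun i => hsys (r i)) hub (he.comp r) hue' hγ.le hnoise
    (fun x hx h0 => by
      refine mul_pos hγ (lt_of_le_of_ne (by positivity) fun hne => ?_)
      have hz : ∀ k, x.2 (Sum.inl k) = 0 := fun k => by
        have := (Finset.sum_eq_zero_iff_of_nonneg fun k _ => sq_nonneg _).1 hne.symm k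
          (Finset.mem_univ k)
        simpa using this
      have h1 := hx.2
      rw [eq_zero_of_crossPoly_eq_zero hz h0] at h1
      simp at h1)
  refine ⟨c, hc, hexc.mono fun n hn θ l hl => ?_⟩
  exact hn ⟨(θ, l), θ.2, by simpa using hl⟩

/-- Before the normalisation, the sums `(1/n) ∑ e_t φ_t` of a family of ARX systems driven by white
noise tend to zero. -/
theorem tendsto_sum_sq_corr_linReg {Θc : Set (Param na nb)} (hstable : UniformlyStable Θc)
    {θ : ι → Param na nb} (hθ : ∀ i, θ i ∈ Θc) {u : ℝ⟦X⟧} {y e : ι → ℝ⟦X⟧}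
    (hsys : ∀ i, (polyA (θ i) : ℝ⟦X⟧) * y i = (polyB (θ i) : ℝ⟦X⟧) * u + e i)
    (hu : BddPow fun _ : ι => u) (he : BddPow e)
    (hee : ∀ k, 1 ≤ k → Uncorr e fun i => PowerSeries.X ^ k * e i)
    (heu : ∀ k, Uncorr e fun _ => PowerSeries.X ^ k * u) :
    Tendsto (fun q : ℕ × ι => ∑ j : Fin na ⊕ Fin nb, (corr q.1 (e q.2)
      (linReg (EuclideanSpace.single j 1) (y q.2) u)) ^ 2) (atTop ×ˢ ⊤) (𝓝 0) := by
  rw [show (0 : ℝ) = ∑ j : Fin na ⊕ Fin nb, (0 : ℝ) ^ 2 by simp]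
  refine tendsto_finsetSum _ fun j _ => Tendsto.pow ?_ 2
  exact uncorr_linReg (l := fun _ => EuclideanSpace.single j 1) hsys
    (dom_polyA_sub_one isCompact_singleton fun _ => Set.mem_singleton _)
    (dom_polyB isCompact_singleton fun _ => Set.mem_singleton _)
    (hstable.dom_inv hθ) (hstable.dom_mul_inv hθ) hu he hee heu

/-! ### Pathwise bounds away from the true parameter -/

section Deterministic

variable {Θc : Set (Param na nb)} (hΘc : IsCompact Θc) {θstar : Param na nb} (hθstar : θstar ∈ Θc)
  (horders : (polyA θstar).coeff na ≠ 0 ∨ (polyB θstar).coeff nb ≠ 0)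
  (hcoprime : IsCoprime (polyA θstar) (polyB θstar)) (hstable : UniformlyStable Θc)
  {u e : ℕ → ℝ} (hu : PersistentlyExciting u (na + nb)) (he : NoiseRegular u e)

include horders hcoprime hu he in
/-- The regressors of the true system are exciting. -/
theorem exists_le_corr_linReg_arxOutput : ∃ c > 0, ∀ᶠ n in atTop, ∀ l : Param na nb, ‖l‖ = 1 →
    c ≤ corr n (linReg l (sig (arxOutput θstar u e)) (sig u))
      (linReg l (sig (arxOutput θstar u e)) (sig u)) := by
  obtain ⟨ρ, hρ, hpos⟩ := hu.exists_limits
  have hK : IsCompact (({θstar} : Set (Param na nb)) ×ˢ Metric.sphere (0 : Param na nb) 1) :=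
    isCompact_singleton.prod (isCompact_sphere _ _)
  obtain ⟨c, hc, h⟩ := exists_le_corr_linReg
    (ι := ↥(({θstar} : Set (Param na nb)) ×ˢ Metric.sphere (0 : Param na nb) 1)) hK
    (z := Subtype.val) (fun i => i.2) hρ hpos (y := fun _ => sig (arxOutput θstar u e))
    (e := fun _ => sig e) (fun i => by
      rw [show (i : Param na nb × Param na nb).1 = θstar from i.2.1]
      exact polyA_mul_sig_arxOutput θstar u e)
    (by have h0 := hρ 0 0
        simp only [pow_zero, one_mul] at h0
        exact bddPow_of_tendsto h0) he.bddPow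
    (fun k l => uncorr_const (he.cross k l)) le_rfl
    (fun δ hδ => Eventually.of_forall fun p => by
      rw [zero_mul, zero_sub]
      exact (neg_nonpos.2 (le_of_lt hδ)).trans (corr_self_nonneg _ _))
    (fun x hx h0 => by
      have h1 := hx.2
      rw [show x.1 = θstar from hx.1] at h0
      rw [eq_zero_of_crossPoly_eq_zero_of_isCoprime horders hcoprime h0] at h1
      simp at h1)
  refine ⟨c, hc, h.mono fun n hn l hl => ?_⟩
  exact hn ⟨(θstar, l), rfl, by simpa using hl⟩

include hΘc hθstar hstable hu he in
theorem uncorr_noise_linReg :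
    Uncorr (fun _ : Θc => sig e)
      fun θ : Θc => linReg (θstar - (θ : Param na nb)) (sig (arxOutput θstar u e)) (sig u) := by
  obtain ⟨ρ, hρ, hpos⟩ := hu.exists_limits
  have hK : IsCompact ((fun θ => θstar - θ) '' Θc) := hΘc.image (by fun_prop)
  have hz : ∀ θ : Θc, θstar - (θ : Param na nb) ∈ (fun θ => θstar - θ) '' Θc :=
    fun θ => ⟨θ, θ.2, rfl⟩
  refine uncorr_linReg (θ := fun _ => θstar) (fun _ => polyA_mul_sig_arxOutput θstar u e)
    (dom_polyA_sub_one hK hz) (dom_polyB hK hz) (hstable.dom_inv fun _ => hθstar)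
    (hstable.dom_mul_inv fun _ => hθstar) ?_ he.bddPow (fun k hk => uncorr_const (he.lag k hk))
    fun k => (uncorr_const ?_).symm
  · have h0 := hρ 0 0
    simp only [pow_zero, one_mul] at h0
    exact bddPow_of_tendsto h0
  · simpa using he.cross k 0

include hΘc hθstar horders hcoprime hstable hu he in
/-- Away from the true parameter, the power of the prediction errors and the reference sum are
bounded from below. -/
theorem exists_le_predError_and_le_reference {ε : ℝ} (hε : 0 < ε) :
    ∃ c > 0, ∀ᶠ n in atTop, ∀ θ ∈ Θc, ε ≤ dist θ θstar →
      c ≤ corr n (sig (predError (arxOutput θstar u e) u θ))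
        (sig (predError (arxOutput θstar u e) u θ)) ∧
      c ≤ ‖shapedSum (regressor na nb (arxOutput θstar u e) u)
        (predError (arxOutput θstar u e) u θ) n‖ ^ 2 := by
  obtain ⟨c, hc, h⟩ := exists_le_corr_linReg_arxOutput horders hcoprime hu he
  set y := arxOutput θstar u e
  have hcε : 0 < c * ε ^ 2 := by positivity
  -- With `g = φᵀ(θ* - θ)`, both quantities are at least `corr g g + 2 corr e g`: the power of `e +
  -- g` drops `corr e e ≥ 0`, and the reference sum is tested with the vector `θ* - θ`. This is at
  -- least `c ε² - 2 · c ε² / 4`.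
  refine ⟨c * ε ^ 2 / 2, by positivity, ?_⟩
  have h1 := (uncorr_noise_linReg hΘc hθstar hstable hu he).eventually
    (lt_mem_nhds (show -(c * ε ^ 2 / 4) < 0 by linarith))
  filter_upwards [h, eventually_forall_of_prod_top h1] with n hn hn1 θ hθ hdist
  have h2 := hn1 ⟨θ, hθ⟩
  simp only at h2
  have hform : ∀ x : Fin na ⊕ Fin nb → ℝ,
      c * (x ⬝ᵥ x) ≤ x ⬝ᵥ (sampleCov (regressor na nb y u) n *ᵥ x) :=
    forall_le_of_forall_unit fun l hl => by
      rw [dotProduct_sampleCov]; exact hn l hl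
  have h3 := hform (θstar - θ).ofLp
  rw [← norm_sq_toLp, dotProduct_sampleCov] at h3
  have h4 : ε ^ 2 ≤ ‖(WithLp.toLp 2 (θstar - θ).ofLp : Param na nb)‖ ^ 2 := by
    rw [WithLp.toLp_ofLp, ← dist_eq_norm, dist_comm]
    gcongr
  have h5 : c * ε ^ 2 ≤ corr n (linReg (θstar - θ) (sig y) (sig u))
      (linReg (θstar - θ) (sig y) (sig u)) :=
    (mul_le_mul_of_nonneg_left h4 hc.le).trans h3
  constructor
  · rw [sig_predError_arxOutput, corr_add_left, corr_add_right, corr_add_right,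
      corr_comm n (linReg _ _ _) (sig e)]
    linarith [corr_self_nonneg n (sig e)]
  · have h6 := le_norm_sq_invSqrt_mulVec
      (posDef_of_forall_le (isHermitian_sampleCov (regressor na nb y u) n) hc hform)
      ((n : ℝ)⁻¹ • ∑ t ∈ Finset.Icc 1 n, predError y u θ t • regressor na nb y u t)
      (θstar - θ).ofLp
    rw [corr_sig_linReg, dotProduct_sampleCov, sig_predError_arxOutput, corr_add_left] at h6
    refine le_trans ?_ h6
    linarith

include hΘc hθstar horders hcoprime hstable hu he in
/-- Away from the true parameter, the sign-perturbed sums tend to zero. -/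
theorem eventually_perturbed_lt {s : ℕ → ℝ} (hs : SignsRegular u e s) {ε δ : ℝ} (hε : 0 < ε)
    (hδ : 0 < δ) :
    ∀ᶠ n in atTop, ∀ θ ∈ Θc, ε ≤ dist θ θstar →
      ‖shapedSum (regressor na nb (perturbedOutput (arxOutput θstar u e) u s θ) u)
        (fun t => s t * predError (arxOutput θstar u e) u θ t) n‖ ^ 2 < δ := by
  obtain ⟨c₀, hc₀, hpow⟩ := exists_le_predError_and_le_reference hΘc hθstar horders hcoprime hstable
    hu he hε
  obtain ⟨ρ, hρ, hpos⟩ := hu.exists_limits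
  set y := arxOutput θstar u e with hy
  set T : Set (Param na nb) := Θc ∩ {θ | ε ≤ dist θ θstar} with hT
  have hTc : IsCompact T :=
    hΘc.inter_right (isClosed_le continuous_const (continuous_id.dist continuous_const))
  have hub : BddPow fun _ : T => sig u := by
    have h0 := hρ 0 0
    simp only [pow_zero, one_mul] at h0
    exact bddPow_of_tendsto h0
  set K₁ : T → ℝ⟦X⟧ := fun θ => (polyA (θ : Param na nb) : ℝ⟦X⟧) * (polyA θstar : ℝ⟦X⟧)⁻¹
  set L₁ : T → ℝ⟦X⟧ := fun θ => (polyA (θ : Param na nb) : ℝ⟦X⟧) *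
    ((polyB θstar : ℝ⟦X⟧) * (polyA θstar : ℝ⟦X⟧)⁻¹) - (polyB (θ : Param na nb) : ℝ⟦X⟧)
  have hK₁ : Dom K₁ := (dom_polyA hTc fun θ => θ.2).mul (hstable.dom_inv fun _ => hθstar)
  have hL₁ : Dom L₁ := ((dom_polyA hTc fun θ => θ.2).mul
    (hstable.dom_mul_inv fun _ => hθstar)).sub (dom_polyB hTc fun θ => θ.2)
  set E : T → ℝ⟦X⟧ := fun θ => sig (fun t => s t * predError y u (θ : Param na nb) t) with hE
  have hE' : ∀ θ, E θ = had (sig s) (K₁ θ * sig e + L₁ θ * sig u) := fun θ => by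
    simp only [hE]
    rw [sig_mul, sig_predError_eq_filtered]
  have hEb : BddPow E := by
    simp only [funext hE']
    exact (bddPow_filtered hK₁ hL₁ hub he.bddPow).had
      fun _ => abs_coeff_sig_le_one hs.sign
  have hEE : ∀ k, 1 ≤ k → Uncorr E fun θ => PowerSeries.X ^ k * E θ := fun k hk => by
    have := hs.uncorr_self hK₁ hL₁ hub he.bddPow hk
    simpa only [← hE'] using this
  have hUE : ∀ k l, Uncorr (fun _ : T => PowerSeries.X ^ k * sig u)
      fun θ => PowerSeries.X ^ l * E θ := fun k l => by
    have := hs.uncorr_input hK₁ hL₁ hub he.bddPow k l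
    simpa only [← hE'] using this
  have hsys : ∀ θ : T, (polyA (θ : Param na nb) : ℝ⟦X⟧) * sig (perturbedOutput y u s (θ : Param na nb))
      = (polyB (θ : Param na nb) : ℝ⟦X⟧) * sig u + E θ :=
    fun θ => polyA_mul_sig_arxOutput _ _ _
  -- Signs do not change the power, so the lower bound for the prediction errors passes to the
  -- perturbed noise. It supplies the excitation at parameters whose polynomials share a factor.
  have hEpow : ∀ᶠ q : ℕ × T in atTop ×ˢ ⊤, 2 * (c₀ / 2) ≤ corr q.1 (E q.2) (E q.2) := by
    have h1 : ∀ᶠ q : ℕ × T in atTop ×ˢ ⊤, ∀ θ ∈ Θc, ε ≤ dist θ θstar →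
        c₀ ≤ corr q.1 (sig (predError y u θ)) (sig (predError y u θ)) :=
      tendsto_fst.eventually (hpow.mono fun n hn θ hθ hd => (hn θ hθ hd).1)
    filter_upwards [h1] with q hq
    simp only [hE]
    rw [sig_mul, hs.corr_had_self _ (coeff_sig_zero _)]
    linarith [hq _ q.2.2.1 q.2.2.2]
  obtain ⟨c, hc, hexc⟩ := exists_le_corr_linReg_of_white hTc hρ hpos hsys hEb hEE hUE
    (half_pos hc₀) hEpow
  have hsum := tendsto_sum_sq_corr_linReg hstable (fun θ : T => θ.2.1) hsys hub hEb hEE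
    fun k => by simpa using (hUE k 0).symm
  have hsmall := eventually_forall_of_prod_top
    (hsum.eventually (gt_mem_nhds (show 0 < c * δ by positivity)))
  filter_upwards [hexc, hsmall] with n h1 h2 θ hθ hd
  have h3 := h2 ⟨θ, hθ, hd⟩
  have hform : ∀ x : Fin na ⊕ Fin nb → ℝ, c * (x ⬝ᵥ x) ≤
      x ⬝ᵥ (sampleCov (regressor na nb (perturbedOutput y u s θ) u) n *ᵥ x) :=
    forall_le_of_forall_unit fun l hl => by
      rw [dotProduct_sampleCov]
      exact h1 ⟨θ, hθ, hd⟩ l hl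
  have h4 := norm_sq_invSqrt_mulVec_le (isHermitian_sampleCov _ n) hc hform
    ((n : ℝ)⁻¹ • ∑ t ∈ Finset.Icc 1 n, (s t * predError y u θ t) •
      regressor na nb (perturbedOutput y u s θ) u t)
  have h5 : ((n : ℝ)⁻¹ • ∑ t ∈ Finset.Icc 1 n, (s t * predError y u θ t) •
      regressor na nb (perturbedOutput y u s θ) u t) ⬝ᵥ ((n : ℝ)⁻¹ • ∑ t ∈ Finset.Icc 1 n,
      (s t * predError y u θ t) • regressor na nb (perturbedOutput y u s θ) u t)
      = ∑ j : Fin na ⊕ Fin nb, (corr n (E ⟨θ, hθ, hd⟩)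
      (linReg (EuclideanSpace.single j 1) (sig (perturbedOutput y u s θ)) (sig u))) ^ 2 := by
    rw [dotProduct]
    refine Finset.sum_congr rfl fun j _ => ?_
    rw [← corr_sig_linReg, ← pow_two]
    congr 1
    simp
  rw [h5] at h4
  exact lt_of_mul_lt_mul_left (h4.trans_lt h3) hc.le

end Deterministic

end SPS

namespace SPS

/-! ### A strong law of large numbers for martingale differences -/

/-- Kronecker's lemma with weights `1, 2, 3, …`. -/
theorem kronecker {x : ℕ → ℝ} {L : ℝ}
    (h : Tendsto (fun n : ℕ => ∑ t ∈ Finset.range n, x t / (t + 1)) atTop (𝓝 L)) :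
    Tendsto (fun n : ℕ => (∑ t ∈ Finset.range n, x t) / n) atTop (𝓝 0) := by
  set S : ℕ → ℝ := fun n => ∑ t ∈ Finset.range n, x t / (t + 1) with hS
  -- Summation by parts: the average equals `S n` minus the Cesàro mean of `S`, and both tend to
  -- `L`.
  have key : ∀ n, ∑ t ∈ Finset.range n, x t = n * S n - ∑ t ∈ Finset.range n, S t := by
    intro n
    induction n with
    | zero => simp
    | succ n ih =>
      rw [Finset.sum_range_succ, Finset.sum_range_succ, ih]
      have h1 : S (n + 1) = S n + x n / (n + 1) := by simp only [hS, Finset.sum_range_succ]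
      rw [h1]
      push_cast
      field_simp
      ring
  have h2 := h.sub h.cesaro
  rw [sub_self] at h2
  refine h2.congr' ?_
  filter_upwards [eventually_ne_atTop 0] with n hn
  rw [key]
  field_simp

variable {Ω : Type*} {mΩ : MeasurableSpace Ω} {μ : Measure Ω}

/-- The strong law of large numbers for square integrable martingale differences. -/
theorem ae_tendsto_average_of_condExp_eq_zero [IsProbabilityMeasure μ] (ℱ : Filtration ℕ mΩ)
    {D : ℕ → Ω → ℝ} (hadp : ∀ t, StronglyMeasurable[ℱ (t + 1)] (D t)) (hL2 : ∀ t, MemLp (D t) 2 μ)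
    (hcond : ∀ t, μ[D t | ℱ t] =ᵐ[μ] 0)
    (hsum : Summable fun t : ℕ => (∫ ω, D t ω ^ 2 ∂μ) / ((t : ℝ) + 1) ^ 2) :
    ∀ᵐ ω ∂μ, Tendsto (fun n : ℕ => (∑ t ∈ Finset.range n, D t ω) / n) atTop (𝓝 0) := by
  -- The weighted sums form a martingale with orthogonal increments, so `E[M_n²]` is a partial sum
  -- of `hsum`. Being bounded in `L²`, hence in `L¹`, it converges almost surely, and Kronecker's
  -- lemma applies.
  set M : ℕ → Ω → ℝ := fun n ω => ∑ t ∈ Finset.range n, D t ω / (t + 1) with hM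
  have hMsucc : ∀ n, M (n + 1) = fun ω => M n ω + D n ω / (n + 1) := fun n => by
    funext ω; simp only [hM, Finset.sum_range_succ]
  have hML2 : ∀ n, MemLp (M n) 2 μ := fun n =>
    memLp_finsetSum _ fun t _ => by
      simpa only [div_eq_inv_mul] using (hL2 t).const_mul (((t : ℝ) + 1)⁻¹)
  have hMadp : ∀ n, StronglyMeasurable[ℱ n] (M n) := by
    intro n
    refine Finset.stronglyMeasurable_fun_sum _ fun t ht => ?_
    have h1 := (hadp t).mono (ℱ.mono (Nat.succ_le_of_lt (Finset.mem_range.1 ht)))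
    simpa only [div_eq_inv_mul] using h1.const_mul (((t : ℝ) + 1)⁻¹)
  have hMint : ∀ n, Integrable (M n) μ := fun n => (hML2 n).integrable (by norm_num)
  have hDint : ∀ n, Integrable (D n) μ := fun n => (hL2 n).integrable (by norm_num)
  have hmart : Martingale M ℱ μ := by
    refine martingale_of_condExp_sub_eq_zero_nat hMadp hMint fun n => ?_
    have h1 : M (n + 1) - M n = ((n : ℝ) + 1)⁻¹ • D n := by
      rw [hMsucc]; funext ω
      simp only [Pi.sub_apply, Pi.smul_apply, smul_eq_mul, div_eq_inv_mul]; ring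
    rw [h1]
    refine (condExp_smul _ _ _).trans ?_
    filter_upwards [hcond n] with ω hω
    simp [hω]
  have hcross : ∀ n, ∫ ω, M n ω * D n ω ∂μ = 0 := by
    intro n
    have hint : Integrable (M n * D n) μ := (hML2 n).integrable_mul (hL2 n)
    have h1 := condExp_mul_of_stronglyMeasurable_left (hMadp n) hint (hDint n)
    have h2 : ∫ ω, (M n * D n) ω ∂μ = 0 := by
      rw [← integral_condExp (ℱ.le n)]
      have h3 : μ[M n * D n | ℱ n] =ᵐ[μ] 0 := by
        refine h1.trans ?_
        filter_upwards [hcond n] with ω hω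
        simp [hω]
      rw [integral_congr_ae h3]; simp
    exact h2
  have hsecond : ∀ n, ∫ ω, M n ω ^ 2 ∂μ
      = ∑ t ∈ Finset.range n, (∫ ω, D t ω ^ 2 ∂μ) / ((t : ℝ) + 1) ^ 2 := by
    intro n
    induction n with
    | zero => simp [hM]
    | succ n ih =>
      rw [Finset.sum_range_succ, ← ih]
      have hi1 : Integrable (fun ω => M n ω ^ 2) μ := (hML2 n).integrable_sq
      have hi2 : Integrable (fun ω => D n ω ^ 2 / ((n : ℝ) + 1) ^ 2) μ :=
        (hL2 n).integrable_sq.div_const _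
      have hi3 : Integrable (fun ω => (2 / ((n : ℝ) + 1)) * (M n ω * D n ω)) μ :=
        ((hML2 n).integrable_mul (hL2 n)).const_mul _
      have h1 : ∀ ω, M (n + 1) ω ^ 2 = M n ω ^ 2 + D n ω ^ 2 / ((n : ℝ) + 1) ^ 2
          + (2 / ((n : ℝ) + 1)) * (M n ω * D n ω) := fun ω => by
        rw [hMsucc]
        field_simp
        ring
      simp only [h1]
      have hi12 : Integrable (fun ω => M n ω ^ 2 + D n ω ^ 2 / ((n : ℝ) + 1) ^ 2) μ := hi1.add hi2
      rw [integral_add hi12 hi3, integral_add hi1 hi2, integral_const_mul, hcross,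
        integral_div]
      ring
  set V := ∑' t : ℕ, (∫ ω, D t ω ^ 2 ∂μ) / ((t : ℝ) + 1) ^ 2
  have hbdd : ∀ n, eLpNorm (M n) 1 μ ≤ ((1 + V).toNNReal : ℝ≥0∞) := by
    intro n
    rw [← ENNReal.ofReal, eLpNorm_one_eq_lintegral_enorm,
      ← ofReal_integral_norm_eq_lintegral_enorm (hMint n)]
    refine ENNReal.ofReal_le_ofReal ?_
    have h1 : ∫ ω, ‖M n ω‖ ∂μ ≤ ∫ ω, (1 + M n ω ^ 2) ∂μ := by
      refine integral_mono (hMint n).norm ((integrable_const 1).add (hML2 n).integrable_sq) ?_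
      intro ω
      simp only [Real.norm_eq_abs]
      nlinarith [sq_nonneg (|M n ω| - 1), sq_abs (M n ω)]
    rw [integral_add (integrable_const 1) (hML2 n).integrable_sq, hsecond] at h1
    refine h1.trans ?_
    simp only [integral_const, probReal_univ, smul_eq_mul, mul_one]
    gcongr
    exact hsum.sum_le_tsum _ fun t _ => div_nonneg (integral_nonneg fun ω => sq_nonneg _)
      (sq_nonneg _)
  filter_upwards [hmart.submartingale.ae_tendsto_limitProcess hbdd] with ω hω
  exact kronecker hω

/-- The strong law of large numbers for products of centred innovations with predictable
factors. -/
theorem ae_tendsto_average_of_indep [IsProbabilityMeasure μ] (ℱ : Filtration ℕ mΩ)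
    {ξ Z : ℕ → Ω → ℝ} (hξ : ∀ t, StronglyMeasurable[ℱ (t + 1)] (ξ t))
    (hξint : ∀ t, Integrable (ξ t) μ) (hξ0 : ∀ t, ∫ ω, ξ t ω ∂μ = 0)
    (hind : ∀ t, Indep (MeasurableSpace.comap (ξ t) inferInstance) (ℱ t) μ)
    (hZ : ∀ t, StronglyMeasurable[ℱ t] (Z t)) (hL2 : ∀ t, MemLp (fun ω => ξ t ω * Z t ω) 2 μ)
    (hsum : Summable fun t : ℕ => (∫ ω, (ξ t ω * Z t ω) ^ 2 ∂μ) / ((t : ℝ) + 1) ^ 2) :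
    ∀ᵐ ω ∂μ, Tendsto (fun n : ℕ => (∑ t ∈ Finset.range n, ξ t ω * Z t ω) / n) atTop (𝓝 0) := by
  refine ae_tendsto_average_of_condExp_eq_zero ℱ
    (fun t => (hξ t).mul ((hZ t).mono (ℱ.mono (Nat.le_succ t)))) hL2 (fun t => ?_) hsum
  have h1 : (fun ω => ξ t ω * Z t ω) = Z t * ξ t := by funext ω; simp [mul_comm]
  have hint : Integrable (Z t * ξ t) μ := by rw [← h1]; exact (hL2 t).integrable (by norm_num)
  rw [h1]
  refine (condExp_mul_of_stronglyMeasurable_left (hZ t) hint (hξint t)).trans ?_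
  have hm : Measurable (ξ t) := ((hξ t).mono (ℱ.le _)).measurable
  have h2 := condExp_indep_eq (f := ξ t) hm.comap_le (ℱ.le t)
    (comap_measurable (ξ t)).stronglyMeasurable (hind t)
  filter_upwards [h2] with ω hω
  simp [hω, hξ0]

/-! ### Averages and weighted series -/

theorem summable_one_div_add_one_sq : Summable fun t : ℕ => 1 / ((t : ℝ) + 1) ^ 2 := by
  have := (summable_nat_add_iff 1).2 (Real.summable_one_div_nat_pow.2 one_lt_two)
  simpa using this

/-- A nonnegative sequence with bounded averages is summable with weights `1 / t²`. -/
theorem summable_div_sq_of_sum_le {b : ℕ → ℝ} (hb : ∀ t, 0 ≤ b t) {C : ℝ}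
    (h : ∀ n : ℕ, ∑ t ∈ Finset.range n, b t ≤ C * n) :
    Summable fun t : ℕ => b t / ((t : ℝ) + 1) ^ 2 := by
  have hC : 0 ≤ C := by simpa using (hb 0).trans (by simpa using h 1)
  have hs := summable_one_div_add_one_sq
  -- Summation by parts as an induction. The constant `3` comes from `k (1/k² - 1/(k+1)²) = (2k+1) /
  -- (k (k+1)²) ≤ 3/(k+1)²`, with `k = n + 1`.
  have key : ∀ n : ℕ, ∑ t ∈ Finset.range (n + 1), b t / ((t : ℝ) + 1) ^ 2
      ≤ (∑ t ∈ Finset.range (n + 1), b t) / ((n : ℝ) + 1) ^ 2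
        + 3 * C * ∑ t ∈ Finset.range (n + 1), 1 / ((t : ℝ) + 1) ^ 2 := by
    intro n
    induction n with
    | zero => simp; positivity
    | succ n ih =>
      rw [Finset.sum_range_succ, Finset.sum_range_succ b, Finset.sum_range_succ (fun t : ℕ => 1 / _)]
      have h1 := h (n + 1)
      set S := ∑ t ∈ Finset.range (n + 1), b t
      have hstep : S / ((n : ℝ) + 1) ^ 2
          ≤ S / (((n + 1 : ℕ) : ℝ) + 1) ^ 2 + 3 * C * (1 / (((n + 1 : ℕ) : ℝ) + 1) ^ 2) := by
        push_cast at h1 ⊢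
        rw [mul_one_div, ← add_div, div_le_div_iff₀ (by positivity) (by positivity)]
        have hn : (0 : ℝ) ≤ n := n.cast_nonneg
        have h2 : S * (2 * n + 3) ≤ C * (n + 1) * (2 * n + 3) :=
          mul_le_mul_of_nonneg_right h1 (by positivity)
        have h3 : 0 ≤ C * (n * (n + 1)) := by positivity
        nlinarith
      rw [add_div, mul_add]
      linarith
  refine summable_of_sum_range_le (c := C + 3 * C * ∑' t : ℕ, 1 / ((t : ℝ) + 1) ^ 2)
    (fun t => div_nonneg (hb t) (sq_nonneg _)) fun n => ?_
  refine (Finset.sum_le_sum_of_subset_of_nonneg (Finset.range_mono (Nat.le_succ n))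
    fun t _ _ => div_nonneg (hb t) (sq_nonneg _)).trans ((key n).trans ?_)
  gcongr
  · rw [div_le_iff₀ (by positivity)]
    refine (h (n + 1)).trans ?_
    push_cast
    have hn : (0 : ℝ) ≤ n := n.cast_nonneg
    have : (n : ℝ) + 1 ≤ (n + 1) ^ 2 := by nlinarith
    gcongr
  · exact hs.sum_le_tsum _ fun t _ => by positivity

/-- Finite upper limits of averages in `[0, ∞]` bound all averages of the real parts. -/
theorem exists_sum_le_of_limsup_lt_top {b : ℕ → ℝ≥0∞}
    (h : limsup (fun n : ℕ => (∑ t ∈ Finset.Icc 1 n, b t) / (n : ℝ≥0∞)) atTop < ∞) :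
    (∀ t, 1 ≤ t → b t ≠ ∞) ∧
      ∃ C : ℝ, ∀ n : ℕ, ∑ t ∈ Finset.range n, (b (t + 1)).toReal ≤ C * n := by
  obtain ⟨C, hC1, hC2⟩ := exists_between h
  obtain ⟨n₀, hn₀⟩ := eventually_atTop.1 (eventually_lt_of_limsup_lt hC1)
  have hfin : ∀ n, n₀ ≤ n → 1 ≤ n → ∑ t ∈ Finset.Icc 1 n, b t ≤ C * n := by
    intro n hn hn1
    refine (ENNReal.div_le_iff_le_mul (Or.inl ?_) (Or.inl (ENNReal.natCast_ne_top n))).1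
      (hn₀ n hn).le
    exact_mod_cast (by omega : n ≠ 0)
  have hne : ∀ t, 1 ≤ t → b t ≠ ∞ := by
    intro t ht
    have h1 := hfin (max n₀ t) (le_max_left _ _) (ht.trans (le_max_right _ _))
    have h2 : b t ≤ ∑ t ∈ Finset.Icc 1 (max n₀ t), b t :=
      Finset.single_le_sum (f := b) (fun _ _ => zero_le) (Finset.mem_Icc.2 ⟨ht, le_max_right _ _⟩)
    exact ((h2.trans h1).trans_lt (ENNReal.mul_lt_top hC2 (ENNReal.natCast_lt_top _))).ne
  refine ⟨hne, ?_⟩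
  have hreal : ∀ n, n₀ ≤ n → 1 ≤ n →
      ∑ t ∈ Finset.range n, (b (t + 1)).toReal ≤ C.toReal * n := by
    intro n hn hn1
    have h1 : ∑ t ∈ Finset.range n, (b (t + 1)).toReal = (∑ t ∈ Finset.Icc 1 n, b t).toReal := by
      rw [ENNReal.toReal_sum fun t ht => hne t (Finset.mem_Icc.1 ht).1]
      rw [Finset.range_eq_Ico, Finset.sum_Ico_add' (fun t => (b t).toReal) 0 n 1]
      rfl
    rw [h1]
    have h2 := ENNReal.toReal_mono (ENNReal.mul_lt_top hC2 (ENNReal.natCast_lt_top n)).ne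
      (hfin n hn hn1)
    simpa using h2
  -- For `1 ≤ n ≤ n₀` the sum is at most the one up to `n₀ + 1`; the enlarged constant absorbs it
  -- because `n ≥ 1`.
  refine ⟨C.toReal * (n₀ + 1 : ℕ), fun n => ?_⟩
  rcases Nat.eq_zero_or_pos n with rfl | hn
  · simp
  have hn1 : (1 : ℝ) ≤ n := by exact_mod_cast hn
  rcases le_total n₀ n with h1 | h1
  · refine (hreal n h1 hn).trans ?_
    have : (1 : ℝ) ≤ (n₀ + 1 : ℕ) := by exact_mod_cast (by omega : 1 ≤ n₀ + 1)
    gcongr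
    exact le_mul_of_one_le_right ENNReal.toReal_nonneg this
  · refine (Finset.sum_le_sum_of_subset_of_nonneg (Finset.range_mono (by omega : n ≤ n₀ + 1))
      fun _ _ _ => ENNReal.toReal_nonneg).trans ((hreal (n₀ + 1) (by omega) (by omega)).trans ?_)
    exact le_mul_of_one_le_right (by positivity) hn1

end SPS

namespace SPS

open PowerSeries (coeff)

variable {Ω : Type*} {mΩ : MeasurableSpace Ω} {μ : Measure Ω}

/-! ### Products of delayed signals with summable fourth moments -/

/-- The fourth moments of the process are finite and summable with weights `1 / t²`. -/
structure FourthMoments (x : ℕ → Ω → ℝ) (μ : Measure Ω) : Prop where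
  meas : ∀ t, 1 ≤ t → Measurable (x t)
  int : ∀ t, 1 ≤ t → Integrable (fun ω => x t ω ^ 4) μ
  sum : Summable fun t : ℕ => (∫ ω, x (t + 1) ω ^ 4 ∂μ) / ((t : ℝ) + 1) ^ 2

/-- The sample `x_{t+1+l-j}` of a process, as a process in `t`. -/
def lagged (x : ℕ → Ω → ℝ) (l j t : ℕ) (ω : Ω) : ℝ := delayed (fun s => x s ω) (t + 1 + l) j

theorem measurable_lagged {m : MeasurableSpace Ω} {x : ℕ → Ω → ℝ} (l j t : ℕ)
    (hx : ∀ s, 1 ≤ s → s + j ≤ t + 1 + l → Measurable[m] (x s)) :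
    Measurable[m] (lagged x l j t) := by
  by_cases h : j < t + 1 + l
  · have : lagged x l j t = x (t + 1 + l - j) := by funext ω; simp [lagged, delayed, h]
    rw [this]
    exact hx _ (by omega) (by omega)
  · have : lagged x l j t = fun _ => 0 := by funext ω; simp [lagged, delayed, h]
    rw [this]
    exact measurable_const

namespace FourthMoments

variable {x y : ℕ → Ω → ℝ}

theorem integrable_lagged (hx : FourthMoments x μ) (l j t : ℕ) :
    Integrable (fun ω => lagged x l j t ω ^ 4) μ := by
  by_cases h : j < t + 1 + l
  · simpa [lagged, delayed, h] using hx.int (t + 1 + l - j) (by omega)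
  · simp [lagged, delayed, h]

/-- The sample time `s = t + 1 + l - j` satisfies `s ≤ (1 + l)(t + 1)`, so replacing the weight
`1/s²` by `1/(t + 1)²` costs at most the factor `(1 + l)²`; samples at times `≤ 0` vanish. -/
theorem summable_lagged (hx : FourthMoments x μ) (l j : ℕ) :
    Summable fun t : ℕ => (∫ ω, lagged x l j t ω ^ 4 ∂μ) / ((t : ℝ) + 1) ^ 2 := by
  set w : ℕ → ℝ := fun s => if s = 0 then 0 else (∫ ω, x s ω ^ 4 ∂μ) / (s : ℝ) ^ 2 with hw
  have hws : Summable w := by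
    rw [← summable_nat_add_iff 1]
    simpa [hw] using hx.sum
  have hw' : Summable fun t => w (t + 1 + l - j) := by
    rw [← summable_nat_add_iff j]
    have h := (summable_nat_add_iff (1 + l)).2 hws
    refine h.congr fun t => ?_
    rw [show t + j + 1 + l - j = t + (1 + l) by omega]
  refine Summable.of_nonneg_of_le
    (fun t => div_nonneg (integral_nonneg fun ω => by positivity) (sq_nonneg _)) (fun t => ?_)
    (hw'.mul_left ((1 + l : ℝ) ^ 2))
  by_cases h : j < t + 1 + l
  · have h0 : t + 1 + l - j ≠ 0 := by omega
    simp only [hw, if_neg h0, lagged, delayed, if_pos h]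
    have hv : 0 ≤ ∫ ω, x (t + 1 + l - j) ω ^ 4 ∂μ := integral_nonneg fun ω => by positivity
    have hs : ((t + 1 + l - j : ℕ) : ℝ) ≤ (1 + l) * (t + 1) := by
      have h1 : ((t + 1 + l - j : ℕ) : ℝ) ≤ ((t + 1 + l : ℕ) : ℝ) := by
        exact_mod_cast Nat.sub_le _ _
      push_cast at h1
      have : (0 : ℝ) ≤ t * l := by positivity
      linarith
    have hs0 : (0 : ℝ) < ((t + 1 + l - j : ℕ) : ℝ) := by exact_mod_cast Nat.pos_of_ne_zero h0
    rw [← mul_div_assoc, div_le_div_iff₀ (by positivity) (by positivity)]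
    have h2 : ((t + 1 + l - j : ℕ) : ℝ) ^ 2 ≤ ((1 + l) * (t + 1)) ^ 2 := by gcongr
    calc _ ≤ (∫ ω, x (t + 1 + l - j) ω ^ 4 ∂μ) * ((1 + l) * ((t : ℝ) + 1)) ^ 2 := by gcongr
      _ = _ := by ring
  · simp only [lagged, delayed, if_neg h]
    have h0 : t + 1 + l - j = 0 := by omega
    simp [hw, h0]

/-- By `(A B)² ≤ A⁴ + B⁴`, fourth moments suffice for the strong law applied to products. The
bounded factor `c` makes room for signs. -/
theorem mul_lagged (hx : FourthMoments x μ) (hy : FourthMoments y μ) {c : ℕ → Ω → ℝ}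
    (hc : ∀ t, AEStronglyMeasurable (c t) μ) (hc1 : ∀ t, ∀ᵐ ω ∂μ, |c t ω| ≤ 1) (l l' j k : ℕ) :
    (∀ t, MemLp (fun ω => c t ω * (lagged x l j t ω * lagged y l' k t ω)) 2 μ) ∧
    Summable fun t : ℕ => (∫ ω, (c t ω * (lagged x l j t ω * lagged y l' k t ω)) ^ 2 ∂μ) /
      ((t : ℝ) + 1) ^ 2 := by
  have hmeas : ∀ t, AEStronglyMeasurable
      (fun ω => c t ω * (lagged x l j t ω * lagged y l' k t ω)) μ := fun t =>
    (hc t).mul ((measurable_lagged l j t fun s hs _ => hx.meas s hs).aestronglyMeasurable.mul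
      (measurable_lagged l' k t fun s hs _ => hy.meas s hs).aestronglyMeasurable)
  have hbound : ∀ t, ∀ᵐ ω ∂μ, (c t ω * (lagged x l j t ω * lagged y l' k t ω)) ^ 2 ≤
      lagged x l j t ω ^ 4 + lagged y l' k t ω ^ 4 := by
    intro t
    filter_upwards [hc1 t] with ω hω
    have h1 : c t ω ^ 2 ≤ 1 := by rw [← sq_abs]; exact pow_le_one₀ (abs_nonneg _) hω
    set A := lagged x l j t ω
    set B := lagged y l' k t ω
    have h2 : (A * B) ^ 2 ≤ A ^ 4 + B ^ 4 := by
      nlinarith [sq_nonneg (A ^ 2 - B ^ 2), sq_nonneg (A ^ 2), sq_nonneg (B ^ 2)]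
    rw [mul_pow]
    exact (mul_le_of_le_one_left (sq_nonneg _) h1).trans h2
  have hint : ∀ t, Integrable (fun ω => lagged x l j t ω ^ 4 + lagged y l' k t ω ^ 4) μ :=
    fun t => (hx.integrable_lagged l j t).add (hy.integrable_lagged l' k t)
  have hsq : ∀ t, Integrable (fun ω => (c t ω * (lagged x l j t ω * lagged y l' k t ω)) ^ 2) μ := by
    intro t
    refine (hint t).mono' ((hmeas t).pow 2) ?_
    filter_upwards [hbound t] with ω hω
    rwa [Real.norm_of_nonneg (sq_nonneg _)]
  refine ⟨fun t => (memLp_two_iff_integrable_sq (hmeas t)).2 (hsq t), ?_⟩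
  refine Summable.of_nonneg_of_le
    (fun t => div_nonneg (integral_nonneg fun ω => sq_nonneg _) (sq_nonneg _)) (fun t => ?_)
    ((hx.summable_lagged l j).add (hy.summable_lagged l' k))
  rw [← add_div, ← integral_add (hx.integrable_lagged l j t) (hy.integrable_lagged l' k t)]
  exact div_le_div_of_nonneg_right (integral_mono_ae (hsq t) (hint t) (hbound t)) (sq_nonneg _)

end FourthMoments

theorem fourthMoments_const [IsProbabilityMeasure μ] {U : ℕ → ℝ}
    (hU4 : limsup (fun n : ℕ => (∑ t ∈ Finset.Icc 1 n, ‖U t‖ₑ ^ 4) / (n : ℝ≥0∞)) atTop < ∞) :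
    FourthMoments (fun t (_ : Ω) => U t) μ := by
  refine ⟨fun _ _ => measurable_const, fun _ _ => integrable_const _, ?_⟩
  obtain ⟨-, C, hC⟩ := exists_sum_le_of_limsup_lt_top hU4
  have h : ∀ t : ℕ, (‖U (t + 1)‖ₑ ^ 4).toReal = U (t + 1) ^ 4 := fun t => by
    rw [ENNReal.toReal_pow, toReal_enorm, Real.norm_eq_abs]
    exact Even.pow_abs ⟨2, rfl⟩ _
  simp only [h] at hC
  simpa using summable_div_sq_of_sum_le (fun t => by positivity) hC

theorem NoiseMoments.fourthMoments [IsProbabilityMeasure μ] {N : ℕ → Ω → ℝ}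
    (hN : NoiseMoments N μ) (hmeas : ∀ t, 1 ≤ t → Measurable (N t)) : FourthMoments N μ := by
  obtain ⟨hfin, C, hC⟩ := exists_sum_le_of_limsup_lt_top hN.2
  have h8 : ∀ t, 1 ≤ t → Integrable (fun ω => N t ω ^ 8) μ := by
    intro t ht
    refine ⟨((hmeas t ht).pow_const 8).aestronglyMeasurable, ?_⟩
    rw [hasFiniteIntegral_iff_enorm]
    simp only [enorm_pow]
    exact (hfin t ht).lt_top
  have hle : ∀ a : ℝ, a ^ 4 ≤ 1 + a ^ 8 := fun a => by nlinarith [sq_nonneg (a ^ 4 - 1), sq_nonneg (a ^ 4)]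
  have h4 : ∀ t, 1 ≤ t → Integrable (fun ω => N t ω ^ 4) μ := by
    intro t ht
    refine ((integrable_const (1 : ℝ)).add (h8 t ht)).mono'
      ((hmeas t ht).pow_const 4).aestronglyMeasurable (Eventually.of_forall fun ω => ?_)
    rw [Real.norm_of_nonneg (by positivity)]
    exact hle _
  refine ⟨hmeas, h4, ?_⟩
  have h8' : ∀ t : ℕ, (∫⁻ ω, ‖N (t + 1) ω‖ₑ ^ 8 ∂μ).toReal = ∫ ω, N (t + 1) ω ^ 8 ∂μ := by
    intro t
    have h1 := integral_norm_eq_lintegral_enorm (h8 (t + 1) (by omega)).aestronglyMeasurable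
    simp only [enorm_pow] at h1
    rw [← h1]
    refine integral_congr_ae (Eventually.of_forall fun ω => ?_)
    exact Real.norm_of_nonneg (by positivity)
  simp only [h8'] at hC
  have hs := summable_one_div_add_one_sq.add (summable_div_sq_of_sum_le
    (fun t => integral_nonneg fun ω => by positivity) hC)
  refine Summable.of_nonneg_of_le
    (fun t => div_nonneg (integral_nonneg fun ω => by positivity) (sq_nonneg _)) (fun t => ?_) hs
  rw [← add_div]
  gcongr
  have h1 : ∫ ω, (1 + N (t + 1) ω ^ 8) ∂μ = 1 + ∫ ω, N (t + 1) ω ^ 8 ∂μ := by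
    rw [integral_add (integrable_const 1) (h8 _ (by omega))]; simp
  rw [← h1]
  exact integral_mono (h4 _ (by omega)) ((integrable_const 1).add (h8 _ (by omega))) fun ω => hle _

/-! ### The filtration of a base `σ`-algebra and of an independent sequence -/

/-- The filtration generated by a base `σ`-algebra and the past of a sequence. -/
def pastFiltration (m₀ : MeasurableSpace Ω) (hm₀ : m₀ ≤ mΩ) (X : ℕ → Ω → ℝ)
    (hX : ∀ t, Measurable[mΩ] (X t)) : Filtration ℕ mΩ where
  seq t := m₀ ⊔ ⨆ s ∈ Set.Iio t, MeasurableSpace.comap (X s) inferInstance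
  mono' _ _ hij := sup_le_sup_left (biSup_mono fun _ hs => lt_of_lt_of_le hs hij) _
  le' _ := sup_le hm₀ (iSup₂_le fun s _ => (hX s).comap_le)

theorem measurable_pastFiltration {m₀ : MeasurableSpace Ω} {hm₀ : m₀ ≤ mΩ} {X : ℕ → Ω → ℝ}
    {hX : ∀ t, Measurable[mΩ] (X t)} {s t : ℕ} (hst : s < t) :
    Measurable[pastFiltration m₀ hm₀ X hX t] (X s) := by
  have h : MeasurableSpace.comap (X s) inferInstance ≤ pastFiltration m₀ hm₀ X hX t :=
    le_sup_of_le_right (le_iSup₂_of_le s hst le_rfl)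
  exact (comap_measurable (X s)).mono h le_rfl

/-- The intersections `s ∩ t` form a π-system generating `m₀ ⊔ m₁`; on them the probability
factorises by splitting off `m₀` first and then separating `m₁` from `m₂`. -/
theorem indep_sup_left [IsProbabilityMeasure μ] {m₀ m₁ m₂ : MeasurableSpace Ω} (h₀ : m₀ ≤ mΩ)
    (h₁ : m₁ ≤ mΩ) (h₂ : m₂ ≤ mΩ) (h12 : Indep m₁ m₂ μ) (h0 : Indep m₀ (m₁ ⊔ m₂) μ) :
    Indep (m₀ ⊔ m₁) m₂ μ := by
  set p : Set (Set Ω) := {u | ∃ s t, MeasurableSet[m₀] s ∧ MeasurableSet[m₁] t ∧ u = s ∩ t}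
  have hp : IsPiSystem p := by
    rintro _ ⟨s, t, hs, ht, rfl⟩ _ ⟨s', t', hs', ht', rfl⟩ -
    exact ⟨s ∩ s', t ∩ t', hs.inter hs', ht.inter ht', Set.inter_inter_inter_comm _ _ _ _⟩
  have hgen : m₀ ⊔ m₁ = MeasurableSpace.generateFrom p := by
    refine le_antisymm (sup_le ?_ ?_) (MeasurableSpace.generateFrom_le ?_)
    · intro s hs
      exact MeasurableSpace.measurableSet_generateFrom
        ⟨s, Set.univ, hs, MeasurableSet.univ, (Set.inter_univ s).symm⟩
    · intro t ht
      exact MeasurableSpace.measurableSet_generateFrom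
        ⟨Set.univ, t, MeasurableSet.univ, ht, (Set.univ_inter t).symm⟩
    · rintro _ ⟨s, t, hs, ht, rfl⟩
      exact MeasurableSet.inter ((le_sup_left : m₀ ≤ m₀ ⊔ m₁) s hs)
        ((le_sup_right : m₁ ≤ m₀ ⊔ m₁) t ht)
  refine IndepSets.indep (sup_le h₀ h₁) h₂ hp (@MeasurableSpace.isPiSystem_measurableSet Ω m₂) hgen
    (@MeasurableSpace.generateFrom_measurableSet Ω m₂).symm ?_
  rw [IndepSets_iff]
  rintro _ u ⟨s, t, hs, ht, rfl⟩ hu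
  rw [Indep_iff] at h12 h0
  have htu : MeasurableSet[m₁ ⊔ m₂] (t ∩ u) :=
    MeasurableSet.inter ((le_sup_left : m₁ ≤ m₁ ⊔ m₂) t ht) ((le_sup_right : m₂ ≤ m₁ ⊔ m₂) u hu)
  rw [Set.inter_assoc, h0 s (t ∩ u) hs htu, h12 t u ht hu,
    h0 s t hs ((le_sup_left : m₁ ≤ m₁ ⊔ m₂) t ht), mul_assoc]

/-- A trivial `m₀` serves the noise. With `m₀` generated by the noise path it serves the signs,
whose predictable factors may then involve the noise at all times, future ones included. -/
theorem indep_pastFiltration [IsProbabilityMeasure μ] {m₀ : MeasurableSpace Ω} {hm₀ : m₀ ≤ mΩ}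
    {X : ℕ → Ω → ℝ} {hX : ∀ t, Measurable[mΩ] (X t)} (hind : iIndepFun X μ)
    (h0 : Indep m₀ (⨆ t, MeasurableSpace.comap (X t) inferInstance) μ) (t : ℕ) :
    Indep (MeasurableSpace.comap (X t) inferInstance) (pastFiltration m₀ hm₀ X hX t) μ := by
  refine Indep.symm (indep_sup_left hm₀ (iSup₂_le fun s _ => (hX s).comap_le) (hX t).comap_le ?_ ?_)
  · have h := indep_iSup_of_disjoint (fun s => (hX s).comap_le) hind
      (S := Set.Iio t) (T := {t}) (by simp)
    simpa using h
  · refine indep_of_indep_of_le_right h0 (sup_le (iSup₂_le fun s _ => ?_) ?_)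
    · exact le_iSup (fun t => MeasurableSpace.comap (X t) inferInstance) s
    · exact le_iSup (fun t => MeasurableSpace.comap (X t) inferInstance) t

end SPS

namespace SPS

open scoped PowerSeries
open PowerSeries (coeff)

/-! ### Correlations as averages of innovations times predictable factors -/

/-- The signal `f` advanced by `l`. -/
def advance (l : ℕ) (f : ℝ⟦X⟧) : ℝ⟦X⟧ := PowerSeries.mk fun t => coeff (t + l) f

/-- When the delayed factor is the innovation, advancing the other factor lets the common delay be
removed and puts the innovation at the current time. The advanced factor stays predictable if it is
deterministic or lies in the initial `σ`-algebra. -/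
theorem corr_X_pow_mul_right (n l : ℕ) (f g : ℝ⟦X⟧) :
    corr n f (PowerSeries.X ^ l * g)
      = corr n (PowerSeries.X ^ l * advance l f) (PowerSeries.X ^ l * g) := by
  rw [corr, corr]
  congr 1
  refine Finset.sum_congr rfl fun t _ => ?_
  by_cases h : l ≤ t
  · rw [PowerSeries.coeff_X_pow_mul' (advance l f), if_pos h, advance, PowerSeries.coeff_mk,
      Nat.sub_add_cancel h]
  · simp [PowerSeries.coeff_X_pow_mul', h]

theorem tendsto_corr_X_pow_mul_right {f g : ℝ⟦X⟧} {l : ℕ} {c : ℝ}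
    (h : Tendsto (fun n => corr n (advance l f) g) atTop (𝓝 c)) :
    Tendsto (fun n => corr n f (PowerSeries.X ^ l * g)) atTop (𝓝 c) := by
  exact (tendsto_corr_X_pow_mul h l).congr fun n => (corr_X_pow_mul_right n l f g).symm

theorem corr_eq_sum_succ {f : ℝ⟦X⟧} (hf : coeff 0 f = 0) (n : ℕ) (g : ℝ⟦X⟧) :
    corr n f g = (∑ t ∈ Finset.range n, coeff (t + 1) f * coeff (t + 1) g) / n := by
  rw [corr, Finset.sum_range_succ', hf, zero_mul, add_zero]

variable {Ω : Type*} {mΩ : MeasurableSpace Ω} {μ : Measure Ω}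

/-! ### Almost sure regularity of the noise -/

/-- Choosing all signs `-1` shows that a noise sample and its negative have the same law. -/
theorem SymmetricNoise.integral_eq_zero {N : ℕ → Ω → ℝ} (h : SymmetricNoise N μ) (t : ℕ) :
    ∫ ω, N (t + 1) ω ∂μ = 0 := by
  have h1 := (h (t + 1) (fun _ => -1) fun _ => Or.inr rfl).comp
    (measurable_pi_apply (Fin.last t))
  have h2 := h1.integral_eq
  simp only [Function.comp_def, Fin.val_last, neg_mul, one_mul, integral_neg] at h2
  linarith

theorem memLp_two_noise_sq {N : ℕ → Ω → ℝ} (hmeas : ∀ t, 1 ≤ t → Measurable (N t))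
    (h4 : FourthMoments N μ) (t : ℕ) : MemLp (fun ω => N (t + 1) ω ^ 2) 2 μ := by
  rw [memLp_two_iff_integrable_sq ((hmeas _ (by omega)).pow_const 2).aestronglyMeasurable]
  refine (h4.int (t + 1) (by omega)).congr (Eventually.of_forall fun ω => ?_)
  ring

variable [IsProbabilityMeasure μ]

section Noise

variable {N : ℕ → Ω → ℝ} (hmeas : ∀ t, 1 ≤ t → Measurable (N t)) (hsymm : SymmetricNoise N μ)
  (hindep : iIndepFun (fun t : ℕ => N (t + 1)) μ) (h4 : FourthMoments N μ)

include hmeas h4 in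
theorem integrable_noise (t : ℕ) : Integrable (N (t + 1)) μ := by
  refine ((integrable_const (1 : ℝ)).add ((memLp_two_noise_sq hmeas h4 t).integrable
    (by norm_num))).mono' (hmeas _ (by omega)).aestronglyMeasurable
    (Eventually.of_forall fun ω => ?_)
  simp only [Pi.add_apply, Real.norm_eq_abs]
  nlinarith [sq_nonneg (|N (t + 1) ω| - 1), sq_abs (N (t + 1) ω)]

include hmeas hsymm hindep h4 in
/-- The noise is uncorrelated with the products of delayed deterministic signals and its past. -/
theorem ae_tendsto_average_noise_mul {x : ℕ → Ω → ℝ} (hx : FourthMoments x μ) (l j : ℕ)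
    (hpast : ∀ t, Measurable[pastFiltration ⊥ bot_le (fun t => N (t + 1))
      (fun t => hmeas (t + 1) (by omega)) t] (lagged x l j t)) :
    ∀ᵐ ω ∂μ, Tendsto (fun n : ℕ => (∑ t ∈ Finset.range n, N (t + 1) ω * lagged x l j t ω) / n)
      atTop (𝓝 0) := by
  have h1 := h4.mul_lagged hx (c := fun _ _ => 1) (fun _ => aestronglyMeasurable_const)
    (fun _ => by simp) 0 l 0 j
  have h2 : ∀ t ω, lagged N 0 0 t ω = N (t + 1) ω := fun t ω => by simp [lagged, delayed]
  simp only [h2, one_mul] at h1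
  exact ae_tendsto_average_of_indep _
    (fun t => (measurable_pastFiltration (Nat.lt_succ_self t)).stronglyMeasurable)
    (integrable_noise hmeas h4) hsymm.integral_eq_zero
    (indep_pastFiltration hindep (indep_bot_left _)) (fun t => (hpast t).stronglyMeasurable)
    h1.1 h1.2

include hmeas hindep h4 in
-- The variance of `N_t²` is at most `E[N_t⁴]`. Together with the convergent averages of `E[N_t²]`
-- this bounds the noise power along the path.
theorem ae_tendsto_average_noise_sq_sub :
    ∀ᵐ ω ∂μ, Tendsto (fun n : ℕ => (∑ t ∈ Finset.range n,
      (N (t + 1) ω ^ 2 - ∫ ω', N (t + 1) ω' ^ 2 ∂μ)) / n) atTop (𝓝 0) := by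
  have hX : ∀ t, Measurable (N (t + 1)) := fun t => hmeas (t + 1) (by omega)
  have hL := memLp_two_noise_sq hmeas h4
  have hint : ∀ t, Integrable (fun ω => N (t + 1) ω ^ 2) μ :=
    fun t => (hL t).integrable (by norm_num)
  have hL' : ∀ t, MemLp (fun ω => N (t + 1) ω ^ 2 - ∫ ω', N (t + 1) ω' ^ 2 ∂μ) 2 μ :=
    fun t => (hL t).sub (memLp_const _)
  have hsq : ∀ t, ∫ ω, (N (t + 1) ω ^ 2 - ∫ ω', N (t + 1) ω' ^ 2 ∂μ) ^ 2 ∂μ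
      ≤ ∫ ω, N (t + 1) ω ^ 4 ∂μ := by
    intro t
    set m := ∫ ω', N (t + 1) ω' ^ 2 ∂μ with hm
    have hi4 := h4.int (t + 1) (by omega)
    have hi2 : Integrable (fun ω => 2 * m * N (t + 1) ω ^ 2) μ := (hint t).const_mul _
    have hi42 : Integrable (fun ω => N (t + 1) ω ^ 4 - 2 * m * N (t + 1) ω ^ 2) μ := hi4.sub hi2
    have h1 : ∀ ω, (N (t + 1) ω ^ 2 - m) ^ 2
        = N (t + 1) ω ^ 4 - 2 * m * N (t + 1) ω ^ 2 + m ^ 2 := fun ω => by ring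
    simp only [h1]
    rw [integral_add hi42 (integrable_const _), integral_sub hi4 hi2, integral_const_mul, ← hm]
    simp only [integral_const, probReal_univ, smul_eq_mul, one_mul]
    nlinarith [sq_nonneg m]
  have hsum : Summable fun t : ℕ =>
      (∫ ω, (N (t + 1) ω ^ 2 - ∫ ω', N (t + 1) ω' ^ 2 ∂μ) ^ 2 ∂μ) / ((t : ℝ) + 1) ^ 2 :=
    Summable.of_nonneg_of_le
      (fun t => div_nonneg (integral_nonneg fun ω => sq_nonneg _) (sq_nonneg _))
      (fun t => div_le_div_of_nonneg_right (hsq t) (sq_nonneg _)) h4.sum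
  have hpm : ∀ t, Measurable[MeasurableSpace.comap (N (t + 1)) inferInstance]
      (fun ω => N (t + 1) ω ^ 2 - ∫ ω', N (t + 1) ω' ^ 2 ∂μ) := fun t =>
    ((comap_measurable (N (t + 1))).pow_const 2).sub_const _
  have h := ae_tendsto_average_of_indep (μ := μ)
    (pastFiltration ⊥ bot_le (fun t => N (t + 1)) hX)
    (ξ := fun t ω => N (t + 1) ω ^ 2 - ∫ ω', N (t + 1) ω' ^ 2 ∂μ) (Z := fun _ _ => 1)
    (fun t => (((measurable_pastFiltration (Nat.lt_succ_self t)).pow_const 2).sub_const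
      _).stronglyMeasurable)
    (fun t => (hL' t).integrable (by norm_num))
    (fun t => by rw [integral_sub (hint t) (integrable_const _)]; simp)
    (fun t => indep_of_indep_of_le_left
      (indep_pastFiltration hindep (indep_bot_left _) t) (hpm t).comap_le)
    (fun t => stronglyMeasurable_const) (fun t => by simpa using hL' t) (by simpa using hsum)
  simpa using h

include hmeas hsymm hindep h4 in
theorem ae_noiseRegular (hmom : NoiseMoments N μ) {U : ℕ → ℝ}
    (hU : FourthMoments (fun t (_ : Ω) => U t) μ) :
    ∀ᵐ ω ∂μ, NoiseRegular U fun t => N t ω := by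
  have h1 : ∀ᵐ ω ∂μ, ∀ k : ℕ, Tendsto (fun n : ℕ =>
      (∑ t ∈ Finset.range n, N (t + 1) ω * lagged N 0 (k + 1) t ω) / n) atTop (𝓝 0) := by
    rw [ae_all_iff]
    refine fun k => ae_tendsto_average_noise_mul hmeas hsymm hindep h4 h4 0 (k + 1) fun t => ?_
    refine measurable_lagged _ _ _ fun s hs hst => ?_
    obtain ⟨r, rfl⟩ := Nat.exists_eq_add_of_le' hs
    exact measurable_pastFiltration (X := fun t => N (t + 1)) (by omega)
  have h2 : ∀ᵐ ω ∂μ, ∀ l k : ℕ, Tendsto (fun n : ℕ =>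
      (∑ t ∈ Finset.range n, N (t + 1) ω * lagged (fun t _ => U t) l k t ω) / n)
      atTop (𝓝 0) := by
    rw [ae_all_iff]; intro l
    rw [ae_all_iff]; intro k
    exact ae_tendsto_average_noise_mul hmeas hsymm hindep h4 hU l k fun t =>
      measurable_lagged _ _ _ fun _ _ _ => measurable_const
  filter_upwards [h1, h2, ae_tendsto_average_noise_sq_sub hmeas hindep h4] with ω h1 h2 h3
  refine ⟨?_, fun k hk => ?_, fun k l => ?_⟩
  · obtain ⟨c, hc⟩ := hmom.1
    have h5 : Tendsto (fun n => corr n (sig fun t => N t ω) (sig fun t => N t ω)) atTop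
        (𝓝 (0 + c)) := by
      refine (h3.add hc).congr fun n => ?_
      rw [corr_eq_sum_succ (coeff_sig_zero _), ← add_div, Finset.sum_sub_distrib]
      have h6 : ∑ t ∈ Finset.Icc 1 n, ∫ ω, N t ω ^ 2 ∂μ
          = ∑ t ∈ Finset.range n, ∫ ω, N (t + 1) ω ^ 2 ∂μ := by
        rw [Finset.range_eq_Ico, Finset.sum_Ico_add' (fun t => ∫ ω, N t ω ^ 2 ∂μ) 0 n 1]
        rfl
      rw [h6, sub_add_cancel]
      congr 1
      refine Finset.sum_congr rfl fun t _ => ?_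
      rw [coeff_sig _ (Nat.succ_ne_zero t), pow_two]
    obtain ⟨C, hC⟩ := h5.bddAbove_range
    exact ⟨C, fun n => hC ⟨n, rfl⟩⟩
  · obtain ⟨r, rfl⟩ := Nat.exists_eq_add_of_le' hk
    refine (h1 r).congr fun n => ?_
    rw [corr_eq_sum_succ (coeff_sig_zero _)]
    congr 1
    refine Finset.sum_congr rfl fun t _ => ?_
    rw [coeff_sig _ (Nat.succ_ne_zero t), coeff_X_pow_mul_sig]
    rfl
  · refine tendsto_corr_X_pow_mul_right ((h2 l k).congr fun n => ?_)
    rw [corr_comm, corr_eq_sum_succ (coeff_sig_zero _)]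
    congr 1
    refine Finset.sum_congr rfl fun t _ => ?_
    rw [coeff_sig _ (Nat.succ_ne_zero t), advance, PowerSeries.coeff_mk, coeff_X_pow_mul_sig]
    rfl

end Noise

/-! ### Almost sure regularity of the signs -/

section Signs

variable {s : ℕ → Ω → ℝ} (hs : ∀ t, Measurable (s t))
  (hp : ∀ t, μ {ω | s t ω = 1} = 1 / 2) (hn : ∀ t, μ {ω | s t ω = -1} = 1 / 2)

include hs hp hn

theorem ae_eq_one_or_neg_one (t : ℕ) : ∀ᵐ ω ∂μ, s t ω = 1 ∨ s t ω = -1 := by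
  have hm1 : MeasurableSet {ω | s t ω = 1} := hs t (measurableSet_singleton _)
  have hm2 : MeasurableSet {ω | s t ω = -1} := hs t (measurableSet_singleton _)
  have hd : Disjoint {ω | s t ω = 1} {ω | s t ω = -1} := by
    rw [Set.disjoint_left]
    intro ω h1 h2
    simp only [Set.mem_ofPred_eq] at h1 h2
    linarith
  have h : μ ({ω | s t ω = 1} ∪ {ω | s t ω = -1}) = 1 := by
    rw [measure_union hd hm2, hp, hn, ENNReal.add_halves]
  exact (prob_compl_eq_zero_iff (hm1.union hm2)).2 h

theorem integral_sign_eq_zero (t : ℕ) : ∫ ω, s t ω ∂μ = 0 := by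
  have hm1 : MeasurableSet {ω | s t ω = 1} := hs t (measurableSet_singleton _)
  have hm2 : MeasurableSet {ω | s t ω = -1} := hs t (measurableSet_singleton _)
  have h : s t =ᵐ[μ] fun ω => {ω | s t ω = 1}.indicator (fun _ => (1 : ℝ)) ω
      - {ω | s t ω = -1}.indicator (fun _ => (1 : ℝ)) ω := by
    filter_upwards [ae_eq_one_or_neg_one hs hp hn t] with ω hω
    rcases hω with h | h <;> norm_num [Set.indicator, h]
  rw [integral_congr_ae h, integral_sub ((integrable_const _).indicator hm1)
    ((integrable_const _).indicator hm2), integral_indicator_const _ hm1,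
    integral_indicator_const _ hm2, Measure.real, Measure.real, hp, hn, sub_self]

theorem ae_tendsto_average_sign_mul (hindep : iIndepFun s μ) {m₀ : MeasurableSpace Ω}
    (hm₀ : m₀ ≤ mΩ) (h0 : Indep m₀ (⨆ t, MeasurableSpace.comap (s t) inferInstance) μ)
    {x y : ℕ → Ω → ℝ} (hx : FourthMoments x μ) (hy : FourthMoments y μ)
    (hxm : ∀ t, 1 ≤ t → Measurable[m₀] (x t)) (hym : ∀ t, 1 ≤ t → Measurable[m₀] (y t))
    {c : ℕ → Ω → ℝ} (hc : ∀ t, Measurable[pastFiltration m₀ hm₀ s hs t] (c t))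
    (hc1 : ∀ t, ∀ᵐ ω ∂μ, |c t ω| ≤ 1) (l j k : ℕ) :
    ∀ᵐ ω ∂μ, Tendsto (fun n : ℕ => (∑ t ∈ Finset.range n,
      s t ω * (c t ω * (lagged x l j t ω * lagged y l k t ω))) / n) atTop (𝓝 0) := by
  have hbase : ∀ t, m₀ ≤ pastFiltration m₀ hm₀ s hs t := fun t => le_sup_left
  have hcm : ∀ t, Measurable[mΩ] (c t) := fun t =>
    (hc t).mono ((pastFiltration m₀ hm₀ s hs).le t) le_rfl
  have hsc : ∀ t, ∀ᵐ ω ∂μ, |s t ω * c t ω| ≤ 1 := fun t => by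
    filter_upwards [hc1 t, ae_eq_one_or_neg_one hs hp hn t] with ω h1 h2
    rcases h2 with h | h <;> simpa [h] using h1
  have h1 := hx.mul_lagged hy (fun t => ((hs t).mul (hcm t)).aestronglyMeasurable) hsc l l j k
  have h2 := ae_tendsto_average_of_indep (μ := μ) (pastFiltration m₀ hm₀ s hs) (ξ := s)
    (Z := fun t ω => c t ω * (lagged x l j t ω * lagged y l k t ω))
    (fun t => (measurable_pastFiltration (Nat.lt_succ_self t)).stronglyMeasurable)
    (fun t => (integrable_const (1 : ℝ)).mono' (hs t).aestronglyMeasurable (by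
      filter_upwards [ae_eq_one_or_neg_one hs hp hn t] with ω h
      rcases h with h | h <;> simp [h]))
    (integral_sign_eq_zero hs hp hn) (indep_pastFiltration hindep h0)
    (fun t => ((hc t).mul (((measurable_lagged l j t fun r hr _ => hxm r hr).mul
      (measurable_lagged l k t fun r hr _ => hym r hr)).mono (hbase t) le_rfl)).stronglyMeasurable)
    (fun t => by simpa only [Pi.mul_apply, mul_assoc] using h1.1 t)
    (by simpa only [Pi.mul_apply, mul_assoc] using h1.2)
  exact h2

end Signs

theorem ae_signsRegular {N : ℕ → Ω → ℝ} (h4 : FourthMoments N μ) {U : ℕ → ℝ}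
    (hU : FourthMoments (fun t (_ : Ω) => U t) μ) {a : ℕ → Ω → ℝ}
    (hs : ∀ t, Measurable (a (t + 1))) (hp : ∀ t, μ {ω | a (t + 1) ω = 1} = 1 / 2)
    (hn : ∀ t, μ {ω | a (t + 1) ω = -1} = 1 / 2) (hindep : iIndepFun (fun t => a (t + 1)) μ)
    {m₀ : MeasurableSpace Ω} (hm₀ : m₀ ≤ mΩ) (hNm : ∀ t, 1 ≤ t → Measurable[m₀] (N t))
    (h0 : Indep m₀ (⨆ t, MeasurableSpace.comap (a (t + 1)) inferInstance) μ) :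
    ∀ᵐ ω ∂μ, SignsRegular U (fun t => N t ω) fun t => a t ω := by
  -- Indexing the noise and the input by `Bool` turns the regularity conditions into a countable
  -- family of almost sure statements.
  set P : Bool → ℕ → Ω → ℝ := fun b => bif b then N else fun t _ => U t with hP
  have hP4 : ∀ b, FourthMoments (P b) μ := by rintro (_ | _); exacts [hU, h4]
  have hPm : ∀ b t, 1 ≤ t → Measurable[m₀] (P b t) := by
    rintro (_ | _) t ht
    exacts [measurable_const, hNm t ht]
  have hsign : ∀ᵐ ω ∂μ, ∀ t, a (t + 1) ω = 1 ∨ a (t + 1) ω = -1 :=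
    ae_all_iff.2 fun t => ae_eq_one_or_neg_one (s := fun t => a (t + 1)) hs hp hn t
  have hlag : ∀ᵐ ω ∂μ, ∀ (l : ℕ) (b b' : Bool) (j k : ℕ), Tendsto (fun n : ℕ =>
      (∑ t ∈ Finset.range n, a (t + 1) ω * (lagged a 0 (l + 1) t ω *
        (lagged (P b) 0 j t ω * lagged (P b') 0 k t ω))) / n) atTop (𝓝 0) := by
    simp only [ae_all_iff]
    intro l b b' j k
    refine ae_tendsto_average_sign_mul (s := fun t => a (t + 1)) hs hp hn hindep hm₀ h0 (hP4 b)
      (hP4 b') (hPm b) (hPm b') (fun t => ?_) (fun t => ?_) 0 j k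
    · refine measurable_lagged _ _ _ fun r hr hrt => ?_
      obtain ⟨q, rfl⟩ := Nat.exists_eq_add_of_le' hr
      exact measurable_pastFiltration (X := fun t => a (t + 1)) (by omega)
    · filter_upwards [hsign] with ω hω
      by_cases h : l + 1 < t + 1 + 0
      · simp only [lagged, delayed, if_pos h]
        rcases hω (t + 1 + 0 - (l + 1) - 1) with h' | h' <;>
          rw [show t + 1 + 0 - (l + 1) - 1 + 1 = t + 1 + 0 - (l + 1) by omega] at h' <;>
          rw [h'] <;> simp
      · simp [lagged, delayed, h]
  have hcross : ∀ᵐ ω ∂μ, ∀ (b : Bool) (j k l : ℕ), Tendsto (fun n : ℕ =>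
      (∑ t ∈ Finset.range n, a (t + 1) ω * (1 *
        (lagged (P false) l j t ω * lagged (P b) l k t ω))) / n) atTop (𝓝 0) := by
    simp only [ae_all_iff]
    intro b j k l
    exact ae_tendsto_average_sign_mul (s := fun t => a (t + 1)) hs hp hn hindep hm₀ h0 (hP4 false)
      (hP4 b) (hPm false) (hPm b) (c := fun _ _ => 1) (fun t => measurable_const)
      (fun t => by simp) l j k
  filter_upwards [hsign, hlag, hcross] with ω h1 h2 h3
  have hmem : ∀ x ∈ ({fun t => N t ω, U} : Set (ℕ → ℝ)), ∃ b, x = fun t => P b t ω := by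
    rintro x (rfl | rfl)
    exacts [⟨true, rfl⟩, ⟨false, rfl⟩]
  refine ⟨fun t ht => ?_, fun l hl x hx y hy j k => ?_, fun x hx j k l => ?_⟩
  · obtain ⟨q, rfl⟩ := Nat.exists_eq_add_of_le' ht
    exact h1 q
  · obtain ⟨q, rfl⟩ := Nat.exists_eq_add_of_le' hl
    obtain ⟨b, rfl⟩ := hmem x hx
    obtain ⟨b', rfl⟩ := hmem y hy
    refine (h2 q b b' j k).congr fun n => ?_
    rw [corr_eq_sum_succ (by rw [coeff_X_pow_mul_sig]; simp [delayed])]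
    congr 1
    refine Finset.sum_congr rfl fun t _ => ?_
    rw [coeff_had, coeff_had, coeff_X_pow_mul_sig, coeff_X_pow_mul_sig, coeff_X_pow_mul_sig,
      coeff_sig _ (Nat.succ_ne_zero t)]
    simp only [lagged, add_zero]
    ring
  · obtain ⟨b, rfl⟩ := hmem x hx
    have h5 : Tendsto (fun n => corr n (advance l (had (PowerSeries.X ^ j * sig U)
        (PowerSeries.X ^ k * sig fun t => P b t ω))) (sig fun t => a t ω)) atTop (𝓝 0) := by
      refine (h3 b j k l).congr fun n => ?_
      rw [corr_comm, corr_eq_sum_succ (coeff_sig_zero _)]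
      congr 1
      refine Finset.sum_congr rfl fun t _ => ?_
      rw [advance, PowerSeries.coeff_mk, coeff_had, coeff_X_pow_mul_sig, coeff_X_pow_mul_sig,
        coeff_sig _ (Nat.succ_ne_zero t), one_mul]
      rfl
    refine (tendsto_corr_X_pow_mul_right h5).congr fun n => ?_
    rw [had_comm (PowerSeries.X ^ l * _), corr_had_right, had_comm]

/-! ### From the sums to the confidence region -/

/-- If the reference value exceeds all other values, its rank is maximal. -/
theorem lt_rankZero {m : ℕ} [NeZero m] {q : ℕ} (hq : 0 < q) (hqm : q < m)
    {π : Equiv.Perm (Fin m)} {Z : Fin m → ℝ} (h : ∀ i, i ≠ 0 → Z i < Z 0) :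
    m - q < rankZero π Z := by
  classical
  have h1 : (Finset.univ.erase (0 : Fin m)).card
      ≤ (Finset.univ.filter fun j : Fin m => Exceeds π Z 0 j).card := by
    refine Finset.card_le_card fun j hj => ?_
    rw [Finset.mem_filter]
    exact ⟨Finset.mem_univ j, Or.inl (h j (Finset.ne_of_mem_erase hj))⟩
  rw [Finset.card_erase_of_mem (Finset.mem_univ _), Finset.card_univ, Fintype.card_fin] at h1
  have h2 : rankZero π Z = 1 + (Finset.univ.filter fun j : Fin m => Exceeds π Z 0 j).card := by
    unfold rankZero
    congr!
  omega

end SPS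

end

theorem theorem2 {Ω : Type*} [MeasurableSpace Ω] (μ : Measure Ω) [IsProbabilityMeasure μ]
    {na nb : ℕ} {m : ℕ} [NeZero m]
    -- the integers `m > q > 0` chosen by the user
    (q : ℕ) (hq : 0 < q) (hqm : q < m)
    -- the compact set of allowed parameters, and the true parameter
    (Θc : Set (SPS.Param na nb)) (hΘc : IsCompact Θc)
    (θstar : SPS.Param na nb) (hθstar : θstar ∈ Θc)
    -- the orders: `a*_{n_a} ≠ 0` or `b*_{n_b} ≠ 0`
    (horders : (SPS.polyA θstar).coeff na ≠ 0 ∨ (SPS.polyB θstar).coeff nb ≠ 0)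
    (hcoprime : IsCoprime (SPS.polyA θstar) (SPS.polyB θstar))
    (hstable : SPS.UniformlyStable Θc)
    -- the deterministic input
    (U : ℕ → ℝ) (hUpe : SPS.PersistentlyExciting U (na + nb))
    (hU4 : limsup (fun n : ℕ => (∑ t ∈ Finset.Icc 1 n, ‖U t‖ₑ ^ 4) / (n : ℝ≥0∞)) atTop < ∞)
    -- the noise
    (N : ℕ → Ω → ℝ) (hNmeas : ∀ t, 1 ≤ t → Measurable (N t))
    (hNsymm : SPS.SymmetricNoise N μ)
    (hNindep : iIndepFun (fun t : ℕ => N (t + 1)) μ)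
    (hNmom : SPS.NoiseMoments N μ)
    -- the random signs and, for each sample size, the tie-breaking permutation
    (α : Fin m → ℕ → Ω → ℝ) (hα : SPS.RandomSigns α μ)
    (hαN : IndepFun (SPS.noisePath N) (SPS.signPath α) μ)
    (π : ℕ → Ω → Equiv.Perm (Fin m)) (hπ : ∀ n, SPS.UniformPermutation (π n) μ)
    (hπindep : ∀ n, IndepFun (fun ω => (⇑(π n ω) : Fin m → Fin m))
      (fun ω => (SPS.noisePath N ω, SPS.signPath α ω)) μ)
    -- the output of the true system
    (Y : ℕ → Ω → ℝ)
    (hY : ∀ t ω, Y t ω = SPS.arxOutput θstar U (fun s => N s ω) t) :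
    ∀ ε : ℝ, 0 < ε → ∀ᵐ ω ∂μ, ∃ nbar : ℕ, ∀ n, nbar ≤ n →
      SPS.region Θc q (fun t => Y t ω) U (fun i t => α i t ω) (π n ω) n
        ⊆ Metric.closedBall θstar ε := by
  intro ε hε
  have hN4 := hNmom.fourthMoments hNmeas
  have hU4' : SPS.FourthMoments (fun t (_ : Ω) => U t) μ := SPS.fourthMoments_const hU4
  have hnoise := SPS.ae_noiseRegular hNmeas hNsymm hNindep hN4 hNmom hU4'
  have hpath : Measurable (SPS.noisePath N) :=
    measurable_pi_lambda _ fun t => hNmeas (t + 1) (by omega)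
  have hsigns : ∀ᵐ ω ∂μ, ∀ i : Fin m, i ≠ 0 →
      SPS.SignsRegular U (fun t => N t ω) fun t => α i t ω := by
    rw [ae_all_iff]
    intro i
    by_cases hi : i = 0
    · exact Eventually.of_forall fun ω h => (h hi).elim
    have h := SPS.ae_signsRegular hN4 hU4' (a := α i)
      (fun t => hα.measurable i hi (t + 1) (by omega))
      (fun t => hα.prob_one i hi (t + 1) (by omega))
      (fun t => hα.prob_neg_one i hi (t + 1) (by omega))
      (hα.indep.precomp (g := fun t : ℕ => ((⟨i, hi⟩, t) : {i : Fin m // i ≠ 0} × ℕ))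
        fun t t' h => congrArg Prod.snd h)
      hpath.comap_le
      (fun t ht => by
        obtain ⟨r, rfl⟩ := Nat.exists_eq_add_of_le' ht
        exact (measurable_pi_apply r).comp (comap_measurable (SPS.noisePath N)))
      (indep_of_indep_of_le_right hαN (iSup_le fun t => Measurable.comap_le
        ((measurable_pi_apply ((⟨i, hi⟩, t) : {i : Fin m // i ≠ 0} × ℕ)).comp
          (comap_measurable (SPS.signPath α)))))
    exact h.mono fun ω hω _ => hω
  -- From here `ω` is fixed; the threshold in `n` depends on `ω` but is common to all `θ`.
  filter_upwards [hnoise, hsigns] with ω hω hsω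
  have hYω : (fun t => Y t ω) = SPS.arxOutput θstar U fun t => N t ω :=
    funext fun t => hY t ω
  obtain ⟨c, hc, href⟩ := SPS.exists_le_predError_and_le_reference hΘc hθstar horders hcoprime
    hstable hUpe hω hε
  have hpert : ∀ᶠ n in atTop, ∀ i : Fin m, i ≠ 0 → ∀ θ ∈ Θc, ε ≤ dist θ θstar →
      ‖SPS.shapedSum (SPS.regressor na nb (SPS.perturbedOutput
        (SPS.arxOutput θstar U fun t => N t ω) U (fun t => α i t ω) θ) U)
        (fun t => α i t ω * SPS.predError (SPS.arxOutput θstar U fun t => N t ω) U θ t) n‖ ^ 2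
        < c := by
    rw [eventually_all]
    intro i
    by_cases hi : i = 0
    · exact Eventually.of_forall fun n h => (h hi).elim
    · exact (SPS.eventually_perturbed_lt hΘc hθstar horders hcoprime hstable hUpe hω (hsω i hi)
        hε hc).mono fun n hn _ => hn
  obtain ⟨nbar, hnbar⟩ := eventually_atTop.1 (href.and hpert)
  refine ⟨nbar, fun n hn θ hθ => ?_⟩
  obtain ⟨h1, h2⟩ := hnbar n hn
  obtain ⟨hθc, hrank⟩ := hθ
  rw [Metric.mem_closedBall]
  by_contra hdist
  have hd : ε ≤ dist θ θstar := (not_le.1 hdist).le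
  -- All perturbed values lie strictly below the reference value, so no tie arises and the rank
  -- exceeds `m - q`.
  refine absurd hrank (not_le.2 (SPS.lt_rankZero hq hqm fun i hi => ?_))
  simp only [SPS.signPerturbedSum, if_neg hi, if_true, hYω]
  exact (h2 i hi θ hθc hd).trans_le (h1 θ hθc hd).2
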